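/- Let $V_3$ denote the volume of a regular ideal tetrahedron in hyperbolic $3$-space $\mathbb{H}^3$. Here an ideal polyhedron is the hyperbolic convex hull of finitely many points of the sphere at infinity which do not all lie on the boundary of one hyperbolic plane, and a regular ideal tetrahedron (respectively cube) is an ideal polyhedron isometric to the one whose vertices, in the Klein ball model, are those of a regular Euclidean tetrahedron (respectively a Euclidean cube) inscribed in the unit sphere. The regular ideal hyperbolic cube has the largest volume among all ideal polyhedra in $\mathbb{H}^3$ with the combinatorial type of the cube, and this volume is $5V_3$, with $V_3$ finite. That is: every regular ideal cube $\mathcal{R}$ is an ideal polyhedron with the combinatorial type of the cube, $\operatorname{vol}(\mathcal{R}) = 5V_3 < \infty$, and every ideal polyhedron $\mathcal{Q}$ whose face lattice is isomorphic to that of the cube satisfies $\operatorname{vol}(\mathcal{Q}) \le \operatorname{vol}(\mathcal{R})$. -/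

import Mathlib

open scoped RealInnerProductSpace

/-- Euclidean 3-space, in which the Klein (projective) model of hyperbolic 3-space lives. -/
abbrev E3 : Type := EuclideanSpace ℝ (Fin 3)

/-- Hyperbolic 3-space in the Klein model: the open unit ball. Its geodesics are the Euclidean
chords, its planes the intersections with Euclidean planes, so that hyperbolic convexity is
Euclidean convexity; its ideal points are the points of the unit sphere. -/
def H3 : Set E3 := Metric.ball 0 1

/-- The hyperbolic distance in the Klein model,
`cosh d(x, y) = (1 - ⟪x, y⟫) / (√(1 - ‖x‖²) √(1 - ‖y‖²))`. -/
noncomputable def kleinDist (x y : E3) : ℝ :=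
  Real.arcosh ((1 - ⟪x, y⟫) / (√(1 - ‖x‖ ^ 2) * √(1 - ‖y‖ ^ 2)))

/-- The Riemannian metric of constant curvature `-1` of the Klein model at `x`,
`ds² = |dx|² / (1 - ‖x‖²) + ⟪x, dx⟫² / (1 - ‖x‖²)²`, as a Gram matrix. -/
noncomputable def kleinMetric (x : E3) : Matrix (Fin 3) (Fin 3) ℝ :=
  (1 - ‖x‖ ^ 2)⁻¹ • (1 : Matrix (Fin 3) (Fin 3) ℝ) +
    ((1 - ‖x‖ ^ 2) ^ 2)⁻¹ • Matrix.vecMulVec (fun i => x i) (fun i => x i)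

/-- Hyperbolic volume of a subset of the Klein model: the integral of the Riemannian volume
element `√(det g) dx`. -/
noncomputable def hypVolume (S : Set E3) : ENNReal :=
  ∫⁻ x in S ∩ H3, ENNReal.ofReal √(kleinMetric x).det

/-- On the Klein model the volume element is `dx / (1 - ‖x‖²)²`. -/
theorem sqrt_det_kleinMetric {x : E3} (hx : x ∈ H3) :
    √(kleinMetric x).det = ((1 - ‖x‖ ^ 2) ^ 2)⁻¹ := by
  have h1 : ‖x‖ < 1 := by simpa [H3] using hx
  have h2 : 0 < 1 - ‖x‖ ^ 2 := by nlinarith [norm_nonneg x]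
  have h3 : ‖x‖ ^ 2 = x 0 ^ 2 + x 1 ^ 2 + x 2 ^ 2 := by
    simp [EuclideanSpace.norm_sq_eq, Fin.sum_univ_three]
  have h4 : (kleinMetric x).det = (((1 - ‖x‖ ^ 2) ^ 2)⁻¹) ^ 2 := by
    rw [Matrix.det_fin_three]
    simp only [kleinMetric, Matrix.add_apply, Matrix.smul_apply, Matrix.vecMulVec_apply,
      Matrix.one_apply, smul_eq_mul]
    simp
    obtain ⟨d, hd⟩ : ∃ d, d = 1 - ‖x‖ ^ 2 := ⟨_, rfl⟩
    rw [← hd] at h2 ⊢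
    have h5 : x 0 ^ 2 = 1 - d - x 1 ^ 2 - x 2 ^ 2 := by linarith
    field_simp
    linear_combination d ^ 2 * h5
  rw [h4, Real.sqrt_sq (by positivity)]

/-- Hyperbolic isometries, as self-maps of the Klein model (the values outside `H3` are
irrelevant). -/
def IsHypIsometry (φ : E3 → E3) : Prop :=
  Set.BijOn φ H3 H3 ∧ ∀ x ∈ H3, ∀ y ∈ H3, kleinDist (φ x) (φ y) = kleinDist x y

/-- The hyperbolic convex hull of a set `V` of ideal points. -/
def idealHull (V : Set E3) : Set E3 := convexHull ℝ V ∩ H3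

/-- An ideal polyhedron: the hyperbolic convex hull of finitely many ideal points that do not
all lie on the boundary of one hyperbolic plane. -/
def IsIdealPolyhedron (P : Set E3) : Prop :=
  ∃ V : Set E3, V.Finite ∧ V ⊆ Metric.sphere 0 1 ∧ affineSpan ℝ V = ⊤ ∧ P = idealHull V

/-- The faces, of all dimensions, of a convex polytope `K` (including `∅` and `K`), ordered by
inclusion: the face lattice of `K`. -/
abbrev FaceLattice (K : Set E3) : Type := {F : Set E3 // IsExposed ℝ K F}

/-- The solid Euclidean cube `[-1, 1]³`. -/
def euclideanCube : Set E3 := {x | ∀ i, |x i| ≤ 1}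

/-- `P ⊆ H3` has the combinatorial type of the cube: adding to `P` its ideal vertices (that is,
taking the closure in the closed unit ball) gives a polytope whose face lattice is isomorphic to
the one of the cube. -/
def HasCubeType (P : Set E3) : Prop :=
  Nonempty (FaceLattice (closure P) ≃o FaceLattice euclideanCube)

/-- The eight points `(±1, ±1, ±1) / √3`, the vertices of a Euclidean cube inscribed in the unit
sphere. -/
def cubeVertices : Set E3 := {x | ∀ i, |x i| = (√3)⁻¹}

/-- Four alternate vertices of this cube, the vertices of a regular Euclidean tetrahedron inscribed
in the unit sphere. -/
def tetrahedronVertices : Set E3 := {x ∈ cubeVertices | 0 < x 0 * x 1 * x 2}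

/-- `P` is a regular ideal cube: up to a hyperbolic isometry it is the one centred at the origin of
the Klein model, whose ideal vertices are those of an inscribed Euclidean cube. -/
def IsRegularIdealCube (P : Set E3) : Prop :=
  ∃ φ, IsHypIsometry φ ∧ P = φ '' idealHull cubeVertices

/-- `P` is a regular ideal tetrahedron: up to a hyperbolic isometry it is the one centred at the
origin of the Klein model, whose ideal vertices are those of an inscribed regular Euclidean
tetrahedron. -/
def IsRegularIdealTetrahedron (P : Set E3) : Prop :=
  ∃ φ, IsHypIsometry φ ∧ P = φ '' idealHull tetrahedronVertices

/-!
The volume of an ideal tetrahedron is computed directly in the Klein model. Lift its vertices to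
null vectors of Minkowski space and parametrize the tetrahedron by their positive combinations. If
the weight of each vertex is the product of the lengths of the edges of the opposite face, the
Minkowski form takes equal values on opposite edges, so that it depends only on the products `p`,
`q`, `r` of the lengths of the three pairs of opposite edges. One integration then leaves
(`hypVolume_idealHull_range`)

  `vol = k / 4 * ∫∫ dy dz / ((p + q y + r z) (p y z + q z + r y))`,

an integral over the positive quadrant, with `k ^ 2 = heron p q r`: here `p`, `q`, `r` are the sides
of a Euclidean triangle of area `k / 4`.

The regular tetrahedron, `p = q = r`, maximizes this volume (`hypVolume_idealHull_range_le`). A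
cyclic relabelling of three vertices permutes `p`, `q`, `r` cyclically, so the volume is the average
of the three integrals, and already the averaged integrands are at most the regular one. Indeed the
denominator is `(p + q + r) ^ 2 y z` plus three squares with coefficients `q r`, `p r`, `p q`, and
convexity of `1 / x` reduces the claim to two isoperimetric inequalities for triangles
(`cyclic_sum_le`, `sum_sqrt_heron_div_linkDenom_le`).

A polyhedron of cube type inherits from the isomorphism of face lattices eight ideal vertices and
six affine functions supporting it along its facets (`exists_cubeConfig`). The plane through the
three neighbours of a vertex cuts off a tetrahedron, and every other vertex lies on the other side
because points of the sphere are extreme. Doing this at four pairwise non-adjacent vertices leaves a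
fifth tetrahedron, whence the volume is a sum of five volumes of ideal tetrahedra
(`CubeConfig.hypVolume_eq_sum`) and is at most five times the regular one.

Finally, an isometry of the Klein model is the restriction of the projective map of a Lorentz
transformation (`IsHypIsometry.exists_isLorentz`). Such maps preserve convex hulls, face lattices
and the ratios `p : q : r`. In the regular cube all five tetrahedra satisfy `p = q = r`, so equality
holds (`IsRegularIdealCube.properties`).
-/

open MeasureTheory Set

/-! ### The pointwise inequality for the volume density -/

/-- Sixteen times the squared area of a Euclidean triangle with sides `p`, `q`, `r`. -/
def heron (p q r : ℝ) : ℝ := (p + q + r) * (p + q - r) * (p - q + r) * (-p + q + r)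

/-- The denominator that remains once the volume form of an ideal tetrahedron has been integrated
along the geodesics ending at one vertex. -/
def linkDenom (p q r y z : ℝ) : ℝ := (p + q * y + r * z) * (p * (y * z) + q * z + r * y)

theorem linkDenom_pos {p q r y z : ℝ} (hp : 0 < p) (hq : 0 < q) (hr : 0 < r) (hy : 0 < y)
    (hz : 0 < z) : 0 < linkDenom p q r y z := by
  unfold linkDenom; positivity

theorem linkDenom_eq (p q r y z : ℝ) : linkDenom p q r y z =
    (p + q + r) ^ 2 * (y * z) +
      (q * r * (y - z) ^ 2 + p * r * (y * (1 - z) ^ 2) + p * q * (z * (1 - y) ^ 2)) := by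
  unfold linkDenom; ring

theorem triangle_of_heron_pos {p q r : ℝ} (hp : 0 < p) (hq : 0 < q) (hr : 0 < r)
    (h : 0 < heron p q r) : 0 < p + q - r ∧ 0 < p - q + r ∧ 0 < -p + q + r := by
  unfold heron at h
  have hs : 0 < p + q + r := by positivity
  have h' : 0 < (p + q - r) * ((p - q + r) * (-p + q + r)) := by
    have : 0 < (p + q + r) * ((p + q - r) * ((p - q + r) * (-p + q + r))) := by
      convert h using 1; ring
    exact pos_of_mul_pos_right (by linarith) hs.le
  -- two of the three factors cannot both be nonpositive, since their sum is `2p`, `2q` or `2r`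
  rcases lt_or_ge 0 (p + q - r) with h1 | h1
  · have h'' := pos_of_mul_pos_right h' h1.le
    rcases lt_or_ge 0 (p - q + r) with h2 | h2
    · exact ⟨h1, h2, pos_of_mul_pos_right h'' h2.le⟩
    · have h3 := neg_of_mul_pos_right h'' h2
      linarith
  · have h'' := neg_of_mul_pos_right h' h1
    rcases lt_or_ge 0 (p - q + r) with h2 | h2
    · have h3 := neg_of_mul_neg_right h'' h2.le
      linarith
    · linarith

/-- Among triangles of given perimeter the equilateral one has the largest area. -/
theorem three_sqrt_three_mul_sqrt_heron_le {p q r : ℝ} (hp : 0 < p) (hq : 0 < q) (hr : 0 < r)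
    (h : 0 < heron p q r) : 3 * √3 * √(heron p q r) ≤ (p + q + r) ^ 2 := by
  obtain ⟨hx, hy, hz⟩ := triangle_of_heron_pos hp hq hr h
  refine abs_le_of_sq_le_sq' ?_ (by positivity) |>.2
  rw [mul_pow, mul_pow, Real.sq_sqrt (by norm_num), Real.sq_sqrt h.le]
  obtain ⟨x, rfl⟩ : ∃ x, x = p + q - r := ⟨_, rfl⟩
  have key : ∀ x y z : ℝ, 0 < x → 0 < y → 0 < z → 27 * (x * y * z) ≤ (x + y + z) ^ 3 := by
    intro x y z hx hy hz
    nlinarith [mul_nonneg hx.le (sq_nonneg (y - z)), mul_nonneg hy.le (sq_nonneg (x - z)),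
      mul_nonneg hz.le (sq_nonneg (x - y)), mul_nonneg (add_pos (add_pos hx hy) hz).le
        (add_nonneg (add_nonneg (sq_nonneg (x - y)) (sq_nonneg (y - z))) (sq_nonneg (x - z)))]
  have := mul_le_mul_of_nonneg_left (key _ _ _ hx hy hz) (by positivity : 0 ≤ p + q + r)
  unfold heron
  calc _ = (p + q + r) * (27 * ((p + q - r) * (p - q + r) * (-p + q + r))) := by ring
    _ ≤ _ := this
    _ = _ := by ring

/-- Among triangles inscribed in a given circle the equilateral one has the largest perimeter. -/
theorem sqrt_heron_mul_le {p q r : ℝ} (hp : 0 < p) (hq : 0 < q) (hr : 0 < r)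
    (h : 0 < heron p q r) : √(heron p q r) * (p + q + r) ≤ 3 * √3 * (p * q * r) := by
  obtain ⟨hx, hy, hz⟩ := triangle_of_heron_pos hp hq hr h
  refine abs_le_of_sq_le_sq' ?_ (by positivity) |>.2
  rw [mul_pow, mul_pow, mul_pow, Real.sq_sqrt h.le, Real.sq_sqrt (by norm_num)]
  have key : ∀ x y z : ℝ, 0 < x → 0 < y → 0 < z →
      (x + y + z) ^ 3 * (x * y * z) * 64 ≤ 27 * ((x + y) * (y + z) * (z + x)) ^ 2 := by
    intro x y z hx hy hz
    have h1 : 8 * ((x + y + z) * (x * y + y * z + z * x)) ≤ 9 * ((x + y) * (y + z) * (z + x)) := by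
      nlinarith [mul_nonneg hx.le (sq_nonneg (y - z)), mul_nonneg hy.le (sq_nonneg (x - z)),
        mul_nonneg hz.le (sq_nonneg (x - y))]
    have h2 : 3 * (x * y * z * (x + y + z)) ≤ (x * y + y * z + z * x) ^ 2 := by
      nlinarith [sq_nonneg (x * y - y * z), sq_nonneg (y * z - z * x), sq_nonneg (x * y - z * x)]
    have h3 := pow_le_pow_left₀ (by positivity) h1 2
    have h4 := mul_le_mul_of_nonneg_left h2 (by positivity : 0 ≤ (x + y + z) ^ 2)
    nlinarith
  have := key _ _ _ hx hy hz
  unfold heron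
  nlinarith

/-- The heart of the maximality of the regular ideal tetrahedron. The three excess terms
of `linkDenom_eq` are permuted cyclically; for a fixed sum the left-hand side is convex in them,
hence largest when only one of them is nonzero, and there the two triangle inequalities above
apply. -/
theorem cyclic_sum_le {c u v w A B C m : ℝ} (hu : 0 < u) (hv : 0 < v) (hw : 0 < w)
    (hA : 0 ≤ A) (hB : 0 ≤ B) (hC : 0 ≤ C) (hm : 0 < m) (hc : 3 * √3 ≤ c)
    (huvw : 1 / u + 1 / v + 1 / w ≤ 3 * √3) :
    1 / (c * m + (u * A + v * B + w * C)) + 1 / (c * m + (v * A + w * B + u * C)) +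
      1 / (c * m + (w * A + u * B + v * C)) ≤ 3 * (1 / (3 * √3 * m + (A + B + C) / √3)) := by
  have h3 : 0 < √3 := by positivity
  have hc0 : 0 < c := by linarith [(by positivity : 0 < 3 * √3)]
  obtain ⟨t, ht⟩ : ∃ t, t = A + B + C := ⟨_, rfl⟩
  have ht0 : 0 ≤ t := by rw [ht]; positivity
  rw [← ht]
  rcases ht0.eq_or_lt with h0 | htpos
  · have hA0 : A = 0 := by linarith
    have hB0 : B = 0 := by linarith
    have hC0 : C = 0 := by linarith
    subst hA0 hB0 hC0
    rw [← h0]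
    simp only [mul_zero, add_zero, zero_div]
    have : 1 / (c * m) ≤ 1 / (3 * √3 * m) := by gcongr
    linarith
  have conv : ∀ x y z, 0 < x → 0 < y → 0 < z →
      1 / (c * m + (x * A + y * B + z * C)) ≤
        A / t * (1 / (c * m + x * t)) + B / t * (1 / (c * m + y * t)) +
          C / t * (1 / (c * m + z * t)) := by
    intro x y z hx hy hz
    have hconv := (convexOn_zpow (𝕜 := ℝ) (-1))
    have e := hconv.map_sum_le (t := Finset.univ) (w := ![A / t, B / t, C / t])
      (p := ![c * m + x * t, c * m + y * t, c * m + z * t]) ?_ ?_ ?_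
    · simp [Fin.sum_univ_three] at e
      have e2 : c * m + (x * A + y * B + z * C) =
          A / t * (c * m + x * t) + B / t * (c * m + y * t) + C / t * (c * m + z * t) := by
        field_simp; rw [ht]; ring
      rw [e2]; simpa using e
    · intro i _; fin_cases i <;> simp <;> positivity
    · simp [Fin.sum_univ_three]; field_simp; exact ht.symm
    · intro i _; fin_cases i <;> simp <;> positivity
  have hsum : 1 / (c * m + (u * A + v * B + w * C)) + 1 / (c * m + (v * A + w * B + u * C)) +
      1 / (c * m + (w * A + u * B + v * C)) ≤
      1 / (c * m + u * t) + 1 / (c * m + v * t) + 1 / (c * m + w * t) := by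
    have h1 := conv u v w hu hv hw
    have h2 := conv v w u hv hw hu
    have h3 := conv w u v hw hu hv
    have e : A / t + B / t + C / t = 1 := by field_simp; exact ht.symm
    have : ∀ a b d : ℝ, (A / t * a + B / t * b + C / t * d) + (A / t * b + B / t * d + C / t * a) +
        (A / t * d + B / t * a + C / t * b) = a + b + d := by
      intro a b d
      linear_combination (a + b + d) * e
    linarith [this (1 / (c * m + u * t)) (1 / (c * m + v * t)) (1 / (c * m + w * t))]
  refine hsum.trans ?_
  -- the tangent line at `√3` of the concave function `x ↦ x / (κ x + t)`, where `x = 1 / u`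
  have tangent : ∀ x, 0 < x → 1 / (c * m + x * t) ≤
      (3 * √3 * m + t / √3)⁻¹ +
        t / (3 * √3 * m * √3 + t) ^ 2 * (1 / x - √3) := by
    intro x hx
    have hle : 1 / (c * m + x * t) ≤ 1 / (3 * √3 * m + x * t) := by gcongr
    refine hle.trans ?_
    obtain ⟨s, hs⟩ : ∃ s, s = 1 / x := ⟨_, rfl⟩
    have hs0 : 0 < s := by rw [hs]; positivity
    have hx' : x = 1 / s := by rw [hs]; simp
    rw [← hs, hx']
    obtain ⟨k, hk⟩ : ∃ k, k = 3 * √3 * m := ⟨_, rfl⟩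
    have hk0 : 0 < k := by rw [hk]; positivity
    rw [← hk]
    obtain ⟨b, hb⟩ : ∃ b, b = √3 := ⟨_, rfl⟩
    rw [← hb] at h3 ⊢
    have e1 : 1 / (k + 1 / s * t) = s / (k * s + t) := by field_simp
    have e2 : (k + t / b)⁻¹ = b / (k * b + t) := by field_simp
    rw [e1, e2]
    have : b / (k * b + t) + t / (k * b + t) ^ 2 * (s - b) - s / (k * s + t) =
        k * t * (s - b) ^ 2 / ((k * b + t) ^ 2 * (k * s + t)) := by
      field_simp; ring
    have : 0 ≤ k * t * (s - b) ^ 2 / ((k * b + t) ^ 2 * (k * s + t)) := by positivity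
    linarith
  have h1 := tangent u hu
  have h2 := tangent v hv
  have h4 := tangent w hw
  have : 0 ≤ t / (3 * √3 * m * √3 + t) ^ 2 * (3 * √3 - (1 / u + 1 / v + 1 / w)) :=
    mul_nonneg (by positivity) (by linarith)
  rw [one_div (3 * √3 * m + t / √3)]
  linarith

/-- Pointwise comparison of the cyclically symmetrized volume density with the regular one. -/
theorem sum_sqrt_heron_div_linkDenom_le {p q r y z : ℝ} (hp : 0 < p) (hq : 0 < q) (hr : 0 < r)
    (h : 0 < heron p q r) (hy : 0 < y) (hz : 0 < z) :
    √(heron p q r) / linkDenom p q r y z + √(heron p q r) / linkDenom q r p y z +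
      √(heron p q r) / linkDenom r p q y z ≤ 3 * (√3 / linkDenom 1 1 1 y z) := by
  have hk : 0 < √(heron p q r) := Real.sqrt_pos.2 h
  have h1 := three_sqrt_three_mul_sqrt_heron_le hp hq hr h
  have h2 := sqrt_heron_mul_le hp hq hr h
  obtain ⟨k, hk'⟩ : ∃ k, k = √(heron p q r) := ⟨_, rfl⟩
  rw [← hk'] at hk h1 h2 ⊢
  have main := cyclic_sum_le (c := (p + q + r) ^ 2 / k) (u := q * r / k) (v := p * r / k)
    (w := p * q / k) (A := (y - z) ^ 2) (B := y * (1 - z) ^ 2) (C := z * (1 - y) ^ 2) (m := y * z)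
    (by positivity) (by positivity) (by positivity) (by positivity) (by positivity)
    (by positivity) (by positivity) (by rw [le_div_iff₀ hk]; exact h1)
    (by
      have : 1 / (q * r / k) + 1 / (p * r / k) + 1 / (p * q / k) =
          k * (p + q + r) / (p * q * r) := by field_simp
      rw [this, div_le_iff₀ (by positivity)]; exact h2)
  have e : ∀ a b c : ℝ, a + b + c = p + q + r → k / linkDenom a b c y z =
      1 / ((p + q + r) ^ 2 / k * (y * z) + (b * c / k * (y - z) ^ 2 +
        a * c / k * (y * (1 - z) ^ 2) + a * b / k * (z * (1 - y) ^ 2))) := by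
    intro a b c habc
    rw [linkDenom_eq, habc, one_div, ← inv_div]
    congr 1
    field_simp
  have e' : √3 / linkDenom 1 1 1 y z = 1 / (3 * √3 * (y * z) +
      ((y - z) ^ 2 + y * (1 - z) ^ 2 + z * (1 - y) ^ 2) / √3) := by
    rw [linkDenom_eq, one_div, ← inv_div]
    congr 1
    have : √3 ^ 2 = 3 := Real.sq_sqrt (by norm_num)
    field_simp
    rw [this]; ring
  rw [e p q r rfl, e q r p (by ring), e r p q (by ring), e']
  refine le_trans (le_of_eq ?_) main
  rw [mul_comm r p, mul_comm q p, mul_comm r q]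

/-! ### The area integral -/

/-- The area integral to which the volume of an ideal tetrahedron reduces; `p`, `q`, `r` are the
products of the Euclidean lengths of opposite edges. -/
noncomputable def linkIntegral (p q r : ℝ) : ENNReal :=
  ∫⁻ u in Ioi (0 : ℝ) ×ˢ Ioi (0 : ℝ), ENNReal.ofReal (1 / linkDenom p q r u.1 u.2)

theorem lintegral_Ioi_one_div_sq {a b : ℝ} (ha : 0 < a) (hb : 0 < b) :
    ∫⁻ t in Ioi (0 : ℝ), ENNReal.ofReal (1 / (a * t + b) ^ 2) = ENNReal.ofReal (1 / (a * b)) := by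
  have hd : ∀ t ∈ Ici (0 : ℝ),
      HasDerivAt (fun t => -(a * (a * t + b))⁻¹) (1 / (a * t + b) ^ 2) t := by
    intro t ht
    have ht : 0 ≤ t := ht
    have h1 : HasDerivAt (fun t => a * (a * t + b)) (a * (a * 1)) t :=
      (((hasDerivAt_id t).const_mul a).add_const b).const_mul a
    refine (h1.fun_inv (by positivity)).fun_neg.congr_deriv ?_
    rw [← neg_div, neg_neg]
    have : 0 < a * t + b := by positivity
    field_simp
  have ht : Filter.Tendsto (fun t => -(a * (a * t + b))⁻¹) Filter.atTop (nhds (-0)) := by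
    refine (Filter.Tendsto.inv_tendsto_atTop ?_).neg
    exact ((Filter.tendsto_id.const_mul_atTop ha).atTop_add tendsto_const_nhds).const_mul_atTop ha
  have hn : ∀ t ∈ Ioi (0 : ℝ), 0 ≤ 1 / (a * t + b) ^ 2 := fun t _ => by positivity
  rw [← ofReal_integral_eq_lintegral_ofReal (integrableOn_Ioi_deriv_of_nonneg' hd hn ht)
    ((ae_restrict_iff' measurableSet_Ioi).2 (Filter.Eventually.of_forall hn)),
    integral_Ioi_of_hasDerivAt_of_nonneg' hd hn ht]
  congr 1
  simp

theorem measurable_linkDenom (p q r : ℝ) :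
    Measurable fun u : ℝ × ℝ => ENNReal.ofReal (1 / linkDenom p q r u.1 u.2) := by
  unfold linkDenom
  fun_prop

theorem linkIntegral_self {p : ℝ} (hp : 0 < p) :
    linkIntegral p p p = ENNReal.ofReal (1 / p ^ 2) * linkIntegral 1 1 1 := by
  unfold linkIntegral
  rw [← lintegral_const_mul _ (measurable_linkDenom 1 1 1)]
  congr 1
  ext u
  rw [← ENNReal.ofReal_mul (by positivity)]
  congr 1
  unfold linkDenom
  rw [div_mul_div_comm]
  congr 1 <;> ring

/-- The dominating one-variable density behaves like `t ^ (-2 / 3)` at zero and like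
`t ^ (-7 / 6)` at infinity. -/
theorem lintegral_rpow_lt_top :
    ∫⁻ t in Ioi (0 : ℝ), ENNReal.ofReal (1 / (√(1 + t) * t ^ (2 / 3 : ℝ))) < ⊤ := by
  rw [← Ioc_union_Ioi_eq_Ioi (zero_le_one' ℝ)]
  refine (lintegral_union_le _ _ _).trans_lt (ENNReal.add_lt_top.2 ⟨?_, ?_⟩)
  · have h : IntegrableOn (fun t : ℝ => t ^ (-(2 / 3) : ℝ)) (Ioc 0 1) := by
      rw [← intervalIntegrable_iff_integrableOn_Ioc_of_le zero_le_one]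
      exact intervalIntegral.intervalIntegrable_rpow' (by norm_num)
    refine lt_of_le_of_lt ?_ h.lintegral_lt_top
    refine setLIntegral_mono' measurableSet_Ioc fun t ht => ENNReal.ofReal_le_ofReal ?_
    have ht0 : 0 < t := ht.1
    rw [Real.rpow_neg ht0.le, one_div]
    have h1 : 1 ≤ √(1 + t) := by rw [Real.one_le_sqrt]; linarith
    have h2 : 0 < t ^ (2 / 3 : ℝ) := by positivity
    gcongr
    nlinarith
  · have h : IntegrableOn (fun t : ℝ => t ^ (-(7 / 6) : ℝ)) (Ioi 1) :=
      integrableOn_Ioi_rpow_of_lt (by norm_num) zero_lt_one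
    refine lt_of_le_of_lt ?_ h.lintegral_lt_top
    refine setLIntegral_mono' measurableSet_Ioi fun t ht => ENNReal.ofReal_le_ofReal ?_
    have ht1 : 1 < t := ht
    have ht0 : 0 < t := by linarith
    have e : t ^ (7 / 6 : ℝ) = √t * t ^ (2 / 3 : ℝ) := by
      rw [Real.sqrt_eq_rpow, ← Real.rpow_add ht0]; norm_num
    rw [Real.rpow_neg ht0.le, one_div, e]
    gcongr
    linarith

/-- Finiteness: the integrand is dominated by a product of two one-variable densities. -/
theorem linkIntegral_one_lt_top : linkIntegral 1 1 1 < ⊤ := by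
  unfold linkIntegral
  rw [Measure.volume_eq_prod, ← Measure.prod_restrict]
  have hm : Measurable fun t : ℝ => ENNReal.ofReal (1 / (√(1 + t) * t ^ (2 / 3 : ℝ))) := by fun_prop
  refine lt_of_le_of_lt ?_ (ENNReal.mul_lt_top lintegral_rpow_lt_top lintegral_rpow_lt_top)
  rw [← lintegral_prod_mul hm.aemeasurable hm.aemeasurable, Measure.prod_restrict]
  refine setLIntegral_mono' (measurableSet_Ioi.prod measurableSet_Ioi) fun u hu => ?_
  have hy : 0 < u.1 := hu.1
  have hz : 0 < u.2 := hu.2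
  rw [← ENNReal.ofReal_mul (by positivity), div_mul_div_comm]
  refine ENNReal.ofReal_le_ofReal ?_
  rw [one_mul]
  refine one_div_le_one_div_of_le (by positivity) ?_
  generalize u.1 = y at hy
  generalize u.2 = z at hz
  have h1 : √(1 + y) * √(1 + z) ≤ 1 + y + z := by
    rw [← Real.sqrt_mul (by positivity)]
    refine Real.sqrt_le_iff.2 ⟨by positivity, ?_⟩
    nlinarith [mul_pos hy hz]
  -- the inequality of arithmetic and geometric means for `y * z`, `z`, `y`
  have h2 : y ^ (2 / 3 : ℝ) * z ^ (2 / 3 : ℝ) ≤ y * z + z + y := by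
    have := Real.geom_mean_le_arith_mean3_weighted (w₁ := 1 / 3) (w₂ := 1 / 3) (w₃ := 1 / 3)
      (p₁ := y * z) (p₂ := z) (p₃ := y) (by norm_num) (by norm_num) (by norm_num)
      (by positivity) hz.le hy.le (by norm_num)
    rw [Real.mul_rpow hy.le hz.le] at this
    have e : ∀ x : ℝ, 0 < x → x ^ (2 / 3 : ℝ) = x ^ (1 / 3 : ℝ) * x ^ (1 / 3 : ℝ) := by
      intro x hx
      rw [← Real.rpow_add hx]; norm_num
    rw [e y hy, e z hz]
    nlinarith [mul_pos hy hz]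
  unfold linkDenom
  calc _ = (√(1 + y) * √(1 + z)) * (y ^ (2 / 3 : ℝ) * z ^ (2 / 3 : ℝ)) := by ring
    _ ≤ (1 + y + z) * (y * z + z + y) := by gcongr
    _ = _ := by ring

/-- Comparison of the area integrals, after cyclic symmetrization. -/
theorem sqrt_heron_mul_linkIntegral_le {p q r : ℝ} (hp : 0 < p) (hq : 0 < q) (hr : 0 < r)
    (h : 0 < heron p q r) :
    ENNReal.ofReal √(heron p q r) *
        (linkIntegral p q r + linkIntegral q r p + linkIntegral r p q) ≤
      3 * (ENNReal.ofReal √3 * linkIntegral 1 1 1) := by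
  unfold linkIntegral
  have m := measurable_linkDenom
  rw [← lintegral_add_left (m p q r), ← lintegral_add_right _ (m r p q),
    ← lintegral_const_mul' _ _ ENNReal.ofReal_ne_top,
    ← lintegral_const_mul' _ _ ENNReal.ofReal_ne_top,
    ← lintegral_const_mul' _ _ (by simp)]
  refine setLIntegral_mono' (measurableSet_Ioi.prod measurableSet_Ioi) fun u hu => ?_
  have hy : 0 < u.1 := hu.1
  have hz : 0 < u.2 := hu.2
  have d1 := linkDenom_pos hp hq hr hy hz
  have d2 := linkDenom_pos hq hr hp hy hz
  have d3 := linkDenom_pos hr hp hq hy hz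
  have d4 := linkDenom_pos one_pos one_pos one_pos hy hz
  have e3 : (3 : ENNReal) = ENNReal.ofReal 3 := by simp
  rw [e3, ← ENNReal.ofReal_add (by positivity) (by positivity),
    ← ENNReal.ofReal_add (by positivity) (by positivity),
    ← ENNReal.ofReal_mul (by positivity), ← ENNReal.ofReal_mul (by positivity),
    ← ENNReal.ofReal_mul (by positivity)]
  refine ENNReal.ofReal_le_ofReal ?_
  have := sum_sqrt_heron_div_linkDenom_le hp hq hr h hy hz
  rw [mul_add, mul_add, mul_one_div, mul_one_div, mul_one_div, mul_one_div]
  exact this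

/-- Integration over the positive octant of `E3`, the third coordinate first. -/
theorem lintegral_octant (F : ℝ → ℝ → ℝ → ENNReal)
    (hF : Measurable fun u : (ℝ × ℝ) × ℝ => F u.1.1 u.1.2 u.2) :
    ∫⁻ y in {y : E3 | ∀ i, 0 < y i}, F (y 0) (y 1) (y 2) =
      ∫⁻ u in Ioi (0 : ℝ) ×ˢ Ioi (0 : ℝ), ∫⁻ t in Ioi (0 : ℝ), F u.1 u.2 t := by
  have e1 := (EuclideanSpace.volume_preserving_symm_measurableEquiv_toLp (Fin 3))
  have e2 := volume_preserving_piFinSuccAbove (fun _ : Fin 3 => ℝ) 2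
  have e3 := (MeasurePreserving.id (volume : Measure ℝ)).prod (volume_preserving_finTwoArrow ℝ)
  have e4 := Measure.measurePreserving_swap (μ := (volume : Measure ℝ))
    (ν := (volume : Measure (ℝ × ℝ)))
  have e : MeasurePreserving (fun y : E3 => ((y 0, y 1), y 2)) volume
      ((volume : Measure (ℝ × ℝ)).prod volume) := e4.comp (e3.comp (e2.comp e1))
  have hS : MeasurableSet ((Ioi (0 : ℝ) ×ˢ Ioi (0 : ℝ)) ×ˢ Ioi (0 : ℝ)) :=
    (measurableSet_Ioi.prod measurableSet_Ioi).prod measurableSet_Ioi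
  have := e.setLIntegral_comp_preimage hS hF
  have hs : (fun y : E3 => ((y 0, y 1), y 2)) ⁻¹' ((Ioi (0 : ℝ) ×ˢ Ioi (0 : ℝ)) ×ˢ Ioi (0 : ℝ)) =
      {y : E3 | ∀ i, 0 < y i} := by
    ext y
    simp [Fin.forall_fin_succ, and_assoc]
  rw [hs] at this
  rw [this, ← Measure.prod_restrict, lintegral_prod _ hF.aemeasurable]

/-! ### Projective parametrization of a simplex -/

/-- The matrix of homogeneous coordinates `(1, v i)` of four points of `E3`; a point of the unit
sphere becomes a null vector of Minkowski space. -/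
def vertexMatrix (v : Fin 4 → E3) : Matrix (Fin 4) (Fin 4) ℝ :=
  Matrix.of fun i => ![1, v i 0, v i 1, v i 2]

theorem E3_norm_sq (x : E3) : ‖x‖ ^ 2 = x 0 ^ 2 + x 1 ^ 2 + x 2 ^ 2 := by
  simp [EuclideanSpace.norm_sq_eq, Fin.sum_univ_three]

theorem E3_dist_sq (x y : E3) :
    dist x y ^ 2 = (x 0 - y 0) ^ 2 + (x 1 - y 1) ^ 2 + (x 2 - y 2) ^ 2 := by
  rw [dist_eq_norm, E3_norm_sq]; simp

theorem affineIndependent_of_vertexMatrix_det_ne_zero {v : Fin 4 → E3}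
    (h : (vertexMatrix v).det ≠ 0) : AffineIndependent ℝ v := by
  rw [affineIndependent_iff_of_fintype]
  intro w hw hs i
  rw [Finset.weightedVSub_eq_linear_combination _ hw] at hs
  have : Matrix.vecMul w (vertexMatrix v) = 0 := by
    ext j
    simp only [Matrix.vecMul, dotProduct, vertexMatrix, Matrix.of_apply, Pi.zero_apply]
    have hc : ∀ k, ∑ i, w i * v i k = 0 := fun k => by
      simpa using congrArg (fun x : E3 => x k) hs
    fin_cases j
    · simpa using hw
    all_goals simpa using hc _
  exact congrFun (Matrix.eq_zero_of_vecMul_eq_zero h this) i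

/-- Four points with independent homogeneous coordinates, as an affine basis. -/
noncomputable def vertexBasis (v : Fin 4 → E3) (h : (vertexMatrix v).det ≠ 0) :
    AffineBasis (Fin 4) ℝ E3 where
  toFun := v
  ind' := affineIndependent_of_vertexMatrix_det_ne_zero h
  tot' := by
    have hi := affineIndependent_of_vertexMatrix_det_ne_zero h
    rw [hi.affineSpan_eq_top_iff_card_eq_finrank_add_one]
    simp

@[simp] theorem vertexBasis_apply (v : Fin 4 → E3) (h : (vertexMatrix v).det ≠ 0) (i : Fin 4) :
    vertexBasis v h i = v i := rfl

theorem affineSpan_range_eq_top {v : Fin 4 → E3} (h : (vertexMatrix v).det ≠ 0) :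
    affineSpan ℝ (range v) = ⊤ := (vertexBasis v h).tot

theorem vertexBasis_coord_sum (v : Fin 4 → E3) (h : (vertexMatrix v).det ≠ 0) (c : Fin 4 → ℝ)
    (hc : ∑ i, c i ≠ 0) (i : Fin 4) :
    (vertexBasis v h).coord i ((∑ j, c j)⁻¹ • ∑ j, c j • v j) = (∑ j, c j)⁻¹ * c i := by
  have hs : ∑ j, (∑ j, c j)⁻¹ * c j = 1 := by
    rw [← Finset.mul_sum, inv_mul_cancel₀ hc]
  have := (vertexBasis v h).coord_apply_combination_of_mem (Finset.mem_univ i) hs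
  rw [← this, Finset.affineCombination_eq_linear_combination _ _ _ hs]
  congr 1
  rw [Finset.smul_sum]
  simp [smul_smul]

/-- For points of the sphere the Gram matrix of the null vectors `(1, v i)` has the entries
`dist (v i) (v j) ^ 2 / 2`, and its determinant factors as in Heron's formula. -/
theorem sixteen_mul_vertexMatrix_det_sq {v : Fin 4 → E3} (hv : ∀ i, ‖v i‖ = 1) :
    16 * (vertexMatrix v).det ^ 2 = heron (dist (v 0) (v 1) * dist (v 2) (v 3))
      (dist (v 0) (v 2) * dist (v 1) (v 3)) (dist (v 0) (v 3) * dist (v 1) (v 2)) := by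
  let J : Matrix (Fin 4) (Fin 4) ℝ := Matrix.diagonal ![1, -1, -1, -1]
  let G : Matrix (Fin 4) (Fin 4) ℝ := Matrix.of fun i j => dist (v i) (v j) ^ 2 / 2
  have hG : vertexMatrix v * J * (vertexMatrix v).transpose = G := by
    ext i j
    have h1 := E3_norm_sq (v i)
    have h2 := E3_norm_sq (v j)
    rw [hv] at h1 h2
    simp only [J, G, Matrix.mul_apply, Fin.sum_univ_four, vertexMatrix,
      Matrix.of_apply, Matrix.transpose_apply, E3_dist_sq]
    simp
    linear_combination (1 / 2) * h1 + (1 / 2) * h2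
  have hJ : J.det = -1 := by
    simp [J, Matrix.det_diagonal, Fin.prod_univ_four]
  have hd := congrArg Matrix.det hG
  rw [Matrix.det_mul, Matrix.det_mul, Matrix.det_transpose, hJ] at hd
  have e : (vertexMatrix v).det ^ 2 = -G.det := by linarith
  rw [e]
  have s : ∀ i j, dist (v j) (v i) = dist (v i) (v j) := fun i j => dist_comm _ _
  simp [G, Matrix.det_succ_row_zero, Fin.sum_univ_succ, Fin.succAbove, Matrix.submatrix, dist_self,
    s 0 1, s 0 2, s 0 3, s 1 2, s 1 3, s 2 3]
  unfold heron
  ring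

/-- Homogeneous coordinates on the positive octant. -/
def homCoord (y : E3) : Fin 4 → ℝ := ![y 0, y 1, y 2, 1]

/-- The projective parametrization of the simplex with vertices `v i` by the positive octant, in
which the vertices are given the weights `w i`. -/
noncomputable def simplexParam (v : Fin 4 → E3) (w : Fin 4 → ℝ) (y : E3) : E3 :=
  (∑ i, w i * homCoord y i)⁻¹ • ∑ i, (w i * homCoord y i) • v i

theorem homCoord_pos {y : E3} (hy : ∀ i, 0 < y i) (i : Fin 4) : 0 < homCoord y i := by
  fin_cases i <;> simp [homCoord, hy]

theorem sum_homCoord_pos {w : Fin 4 → ℝ} (hw : ∀ i, 0 < w i) {y : E3} (hy : ∀ i, 0 < y i) :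
    0 < ∑ i, w i * homCoord y i :=
  Finset.sum_pos (fun i _ => mul_pos (hw i) (homCoord_pos hy i)) Finset.univ_nonempty

theorem simplexParam_image {v : Fin 4 → E3} (h : (vertexMatrix v).det ≠ 0) {w : Fin 4 → ℝ}
    (hw : ∀ i, 0 < w i) :
    simplexParam v w '' {y | ∀ i, 0 < y i} = interior (convexHull ℝ (range v)) := by
  have : interior (convexHull ℝ (range v)) = {x | ∀ i, 0 < (vertexBasis v h).coord i x} :=
    AffineBasis.interior_convexHull (vertexBasis v h)
  rw [this]
  ext x
  constructor
  · rintro ⟨y, hy, rfl⟩ i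
    have := sum_homCoord_pos hw hy
    rw [simplexParam, vertexBasis_coord_sum v h _ this.ne']
    have h1 := mul_pos (hw i) (homCoord_pos hy i)
    positivity
  · intro hx
    have hx : ∀ i, 0 < (vertexBasis v h).coord i x := hx
    obtain ⟨c, hc⟩ : ∃ c : Fin 4 → ℝ, ∀ i, c i = (vertexBasis v h).coord i x := ⟨_, fun _ => rfl⟩
    have hc0 : ∀ i, 0 < c i := fun i => (hc i).symm ▸ hx i
    refine ⟨!₂[c 0 / w 0 * (w 3 / c 3), c 1 / w 1 * (w 3 / c 3), c 2 / w 2 * (w 3 / c 3)], ?_, ?_⟩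
    · have := hw 0; have := hw 1; have := hw 2; have := hw 3
      have := hc0 0; have := hc0 1; have := hc0 2; have := hc0 3
      intro i
      fin_cases i <;> simp <;> positivity
    · have e : ∀ i, w i * homCoord !₂[c 0 / w 0 * (w 3 / c 3), c 1 / w 1 * (w 3 / c 3),
          c 2 / w 2 * (w 3 / c 3)] i = w 3 / c 3 * c i := by
        have := (hw 0).ne'; have := (hw 1).ne'; have := (hw 2).ne'; have := (hw 3).ne'
        have := (hc0 3).ne'
        intro i
        fin_cases i <;> simp [homCoord] <;> field_simp
      rw [simplexParam]
      simp only [e]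
      have h1 : ∑ i, c i = 1 := by
        simp only [hc]; exact (vertexBasis v h).sum_coord_apply_eq_one x
      have h2 : ∑ i, c i • v i = x := by
        simp only [hc]; exact (vertexBasis v h).linear_combination_coord_eq_self x
      rw [← Finset.mul_sum, h1]
      simp only [mul_smul]
      rw [← Finset.smul_sum, h2, smul_smul, mul_one, inv_mul_cancel₀, one_smul]
      exact (div_pos (hw 3) (hc0 3)).ne'

theorem simplexParam_injOn {v : Fin 4 → E3} (h : (vertexMatrix v).det ≠ 0) {w : Fin 4 → ℝ}
    (hw : ∀ i, 0 < w i) : InjOn (simplexParam v w) {y | ∀ i, 0 < y i} := by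
  intro y hy z hz hyz
  have h1 := sum_homCoord_pos hw hy
  have h2 := sum_homCoord_pos hw hz
  have e : ∀ i, (∑ i, w i * homCoord y i)⁻¹ * (w i * homCoord y i) =
      (∑ i, w i * homCoord z i)⁻¹ * (w i * homCoord z i) := by
    intro i
    have := congrArg ((vertexBasis v h).coord i) hyz
    rwa [simplexParam, simplexParam, vertexBasis_coord_sum v h _ h1.ne',
      vertexBasis_coord_sum v h _ h2.ne'] at this
  have e3 : (∑ i, w i * homCoord y i)⁻¹ = (∑ i, w i * homCoord z i)⁻¹ := by
    simpa [homCoord, (hw 3).ne'] using e 3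
  have e' : ∀ i, homCoord y i = homCoord z i := fun i => by
    have := e i
    rw [e3] at this
    exact mul_left_cancel₀ (hw i).ne' (mul_left_cancel₀ (inv_pos.2 h2).ne' this)
  ext i
  fin_cases i
  exacts [e' 0, e' 1, e' 2]

/-- The derivative of `simplexParam`. -/
noncomputable def simplexParamDeriv (v : Fin 4 → E3) (w : Fin 4 → ℝ) (y : E3) : E3 →L[ℝ] E3 :=
  ∑ i : Fin 3, ((∑ i, w i * homCoord y i)⁻¹ * w i.castSucc) •
    (EuclideanSpace.proj i : E3 →L[ℝ] ℝ).smulRight (v i.castSucc - simplexParam v w y)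

theorem hasFDerivAt_simplexParam (v : Fin 4 → E3) {w : Fin 4 → ℝ} (hw : ∀ i, 0 < w i)
    {y : E3} (hy : ∀ i, 0 < y i) :
    HasFDerivAt (simplexParam v w) (simplexParamDeriv v w y) y := by
  have hm := sum_homCoord_pos hw hy
  have hp : ∀ i : Fin 3, HasFDerivAt (fun y : E3 => y i) (EuclideanSpace.proj i : E3 →L[ℝ] ℝ) y :=
    fun i => (EuclideanSpace.proj i : E3 →L[ℝ] ℝ).hasFDerivAt
  have h1 : HasFDerivAt (fun y : E3 => ∑ i, w i * homCoord y i)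
      (∑ i : Fin 3, w i.castSucc • (EuclideanSpace.proj i : E3 →L[ℝ] ℝ)) y := by
    simp only [Fin.sum_univ_four, Fin.sum_univ_three, homCoord]
    exact ((((hp 0).const_mul (w 0)).fun_add ((hp 1).const_mul (w 1))).fun_add
      ((hp 2).const_mul (w 2))).add_const (w 3 * 1)
  have h2 : HasFDerivAt (fun y : E3 => ∑ i, (w i * homCoord y i) • v i)
      (∑ i : Fin 3, (w i.castSucc • (EuclideanSpace.proj i : E3 →L[ℝ] ℝ)).smulRight
        (v i.castSucc)) y := by
    simp only [Fin.sum_univ_four, Fin.sum_univ_three, homCoord]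
    exact (((((hp 0).const_mul (w 0)).smul_const (v 0)).fun_add
      (((hp 1).const_mul (w 1)).smul_const (v 1))).fun_add
      (((hp 2).const_mul (w 2)).smul_const (v 2))).add_const ((w 3 * 1) • v 3)
  have h3 := ((hasDerivAt_inv hm.ne').comp_hasFDerivAt y h1).smul h2
  refine h3.congr_fderiv ?_
  ext1 z
  simp only [simplexParamDeriv, simplexParam, Fin.sum_univ_three]
  simp
  module

/-- The Jacobian of the parametrization. -/
theorem abs_det_simplexParamDeriv (v : Fin 4 → E3) {w : Fin 4 → ℝ} (hw : ∀ i, 0 < w i)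
    {y : E3} (hy : ∀ i, 0 < y i) :
    |(simplexParamDeriv v w y).det| =
      w 0 * w 1 * w 2 * w 3 * |(vertexMatrix v).det| / (∑ i, w i * homCoord y i) ^ 4 := by
  have hm := sum_homCoord_pos hw hy
  have key : (simplexParamDeriv v w y).det =
      w 0 * w 1 * w 2 * w 3 * -(vertexMatrix v).det / (∑ i, w i * homCoord y i) ^ 4 := by
    rw [ContinuousLinearMap.det,
      ← LinearMap.det_toMatrix (EuclideanSpace.basisFun (Fin 3) ℝ).toBasis,
      Matrix.det_fin_three]
    obtain ⟨m, hm'⟩ : ∃ m, m = ∑ i, w i * homCoord y i := ⟨_, rfl⟩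
    obtain ⟨g, hg⟩ : ∃ g, g = simplexParam v w y := ⟨_, rfl⟩
    have e : ∀ i j, LinearMap.toMatrix (EuclideanSpace.basisFun (Fin 3) ℝ).toBasis
        (EuclideanSpace.basisFun (Fin 3) ℝ).toBasis (simplexParamDeriv v w y : E3 →ₗ[ℝ] E3) i j =
        m⁻¹ * w j.castSucc * (v j.castSucc i - g i) := by
      intro i j
      rw [LinearMap.toMatrix_apply]
      simp [simplexParamDeriv, ← hm', ← hg]
    have hgm : ∀ k, m * g k = w 0 * y 0 * v 0 k + w 1 * y 1 * v 1 k + w 2 * y 2 * v 2 k +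
        w 3 * v 3 k := by
      intro k
      rw [hg, simplexParam, ← hm']
      rw [← hm'] at hm
      simp [Fin.sum_univ_four, homCoord]
      field_simp
    simp only [e]
    rw [← hm'] at hm ⊢
    have hm3 : m = w 0 * y 0 + w 1 * y 1 + w 2 * y 2 + w 3 := by
      simp [hm', Fin.sum_univ_four, homCoord]
    have g0 := hgm 0
    have g1 := hgm 1
    have g2 := hgm 2
    have hw3 := (hw 3).ne'
    -- express `v 3` through the image point `g`; the claim becomes a polynomial identity
    rw [← sub_eq_iff_eq_add', eq_comm, mul_comm, ← eq_div_iff hw3] at g0 g1 g2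
    have hN : (vertexMatrix v).det = Matrix.det !![1, v 0 0, v 0 1, v 0 2; 1, v 1 0, v 1 1, v 1 2;
      1, v 2 0, v 2 1, v 2 2; 1, v 3 0, v 3 1, v 3 2] := by
      congr 1
      ext i j
      fin_cases i <;> fin_cases j <;> rfl
    rw [hN]
    simp [Matrix.det_succ_row_zero (n := 3), Fin.sum_univ_succ, Fin.succAbove, Matrix.submatrix,
      Matrix.det_fin_three]
    rw [g0, g1, g2]
    have hm0 := hm.ne'
    field_simp
    rw [hm3]
    ring
  rw [key, abs_div, abs_mul, abs_neg, abs_of_pos (pow_pos hm 4), abs_of_pos]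
  have := hw 0; have := hw 1; have := hw 2; have := hw 3
  positivity

/-! ### The volume of an ideal tetrahedron -/

/-- The product of the lengths of the edges `v i v j` and `v k v l`. -/
noncomputable def edgeProd (v : Fin 4 → E3) (i j k l : Fin 4) : ℝ :=
  dist (v i) (v j) * dist (v k) (v l)

theorem convexHull_subset_closedBall {V : Set E3} (hV : ∀ x ∈ V, ‖x‖ ≤ 1) :
    convexHull ℝ V ⊆ Metric.closedBall 0 1 :=
  convexHull_min (fun x hx => by simpa using hV x hx) (convex_closedBall 0 1)

theorem interior_convexHull_subset_H3 {V : Set E3} (hV : ∀ x ∈ V, ‖x‖ ≤ 1) :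
    interior (convexHull ℝ V) ⊆ H3 := by
  have := interior_mono (convexHull_subset_closedBall hV)
  rwa [interior_closedBall _ one_ne_zero] at this

theorem idealHull_ae_eq_interior {V : Set E3} (hV : ∀ x ∈ V, ‖x‖ ≤ 1) :
    idealHull V =ᵐ[volume] interior (convexHull ℝ V) := by
  have h0 : volume (frontier (convexHull ℝ V)) = 0 := (convex_convexHull ℝ V).addHaar_frontier _
  refine Filter.EventuallyLE.antisymm ?_ ?_
  · rw [ae_le_set]
    refine measure_mono_null ?_ h0
    rintro x ⟨⟨h1, _⟩, h2⟩
    exact ⟨subset_closure h1, h2⟩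
  · exact LE.le.eventuallyLE
      fun x hx => ⟨interior_subset hx, interior_convexHull_subset_H3 hV hx⟩

/-- The Minkowski form on positive combinations of the null vectors `(1, v i)`. -/
theorem sum_sq_mul_one_sub_norm_simplexParam {v : Fin 4 → E3} (hv : ∀ i, ‖v i‖ = 1)
    {w : Fin 4 → ℝ} (hw : ∀ i, 0 < w i) {y : E3} (hy : ∀ i, 0 < y i) :
    (∑ i, w i * homCoord y i) ^ 2 * (1 - ‖simplexParam v w y‖ ^ 2) =
      w 0 * w 1 * dist (v 0) (v 1) ^ 2 * (y 0 * y 1) +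
      w 0 * w 2 * dist (v 0) (v 2) ^ 2 * (y 0 * y 2) +
      w 0 * w 3 * dist (v 0) (v 3) ^ 2 * y 0 + w 1 * w 2 * dist (v 1) (v 2) ^ 2 * (y 1 * y 2) +
      w 1 * w 3 * dist (v 1) (v 3) ^ 2 * y 1 + w 2 * w 3 * dist (v 2) (v 3) ^ 2 * y 2 := by
  have hm := sum_homCoord_pos hw hy
  have n : ∀ i, 1 = v i 0 ^ 2 + v i 1 ^ 2 + v i 2 ^ 2 := fun i => by
    rw [← E3_norm_sq, hv, one_pow]
  have e : (∑ i, w i * homCoord y i) ^ 2 * (1 - ‖simplexParam v w y‖ ^ 2) =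
      (∑ i, w i * homCoord y i) ^ 2 - ‖∑ i, (w i * homCoord y i) • v i‖ ^ 2 := by
    rw [simplexParam, norm_smul, mul_pow, norm_inv, Real.norm_eq_abs, abs_of_pos hm]
    field_simp
  rw [e, E3_norm_sq]
  simp only [Fin.sum_univ_four, homCoord, E3_dist_sq]
  simp
  linear_combination
    (w 0 * y 0 * (w 0 * y 0 + w 1 * y 1 + w 2 * y 2 + w 3)) * n 0 +
    (w 1 * y 1 * (w 0 * y 0 + w 1 * y 1 + w 2 * y 2 + w 3)) * n 1 +
    (w 2 * y 2 * (w 0 * y 0 + w 1 * y 1 + w 2 * y 2 + w 3)) * n 2 +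
    (w 3 * (w 0 * y 0 + w 1 * y 1 + w 2 * y 2 + w 3)) * n 3

theorem vertexMatrix_injective {v : Fin 4 → E3} (h : (vertexMatrix v).det ≠ 0) :
    Function.Injective v := (affineIndependent_of_vertexMatrix_det_ne_zero h).injective

theorem measurableSet_octant : MeasurableSet {y : E3 | ∀ i, 0 < y i} := by
  rw [ofPred_forall]
  refine MeasurableSet.iInter fun i => measurableSet_lt measurable_const ?_
  exact (EuclideanSpace.proj i : E3 →L[ℝ] ℝ).measurable

/-- The volume of an ideal tetrahedron. The weight of a vertex is the product of the edge lengths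
of the opposite face: then the quadratic form of Minkowski space takes the same value on opposite
edges. -/
theorem hypVolume_idealHull_range {v : Fin 4 → E3} (hv : ∀ i, ‖v i‖ = 1)
    (h : (vertexMatrix v).det ≠ 0) :
    hypVolume (idealHull (range v)) = ENNReal.ofReal |(vertexMatrix v).det| *
      linkIntegral (edgeProd v 0 1 2 3) (edgeProd v 0 2 1 3) (edgeProd v 0 3 1 2) := by
  have hpos : ∀ i j, i ≠ j → 0 < dist (v i) (v j) :=
    fun i j hij => dist_pos.2 fun e => hij (vertexMatrix_injective h e)
  have d01 := hpos 0 1 (by decide)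
  have d02 := hpos 0 2 (by decide)
  have d03 := hpos 0 3 (by decide)
  have d12 := hpos 1 2 (by decide)
  have d13 := hpos 1 3 (by decide)
  have d23 := hpos 2 3 (by decide)
  obtain ⟨p, hp⟩ : ∃ p, p = edgeProd v 0 1 2 3 := ⟨_, rfl⟩
  obtain ⟨q, hq⟩ : ∃ q, q = edgeProd v 0 2 1 3 := ⟨_, rfl⟩
  obtain ⟨r, hr⟩ : ∃ r, r = edgeProd v 0 3 1 2 := ⟨_, rfl⟩
  have hp0 : 0 < p := hp ▸ mul_pos d01 d23
  have hq0 : 0 < q := hq ▸ mul_pos d02 d13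
  have hr0 : 0 < r := hr ▸ mul_pos d03 d12
  rw [← hp, ← hq, ← hr]
  obtain ⟨w, hw⟩ : ∃ w : Fin 4 → ℝ, w =
      ![dist (v 1) (v 2) * dist (v 1) (v 3) * dist (v 2) (v 3),
        dist (v 0) (v 2) * dist (v 0) (v 3) * dist (v 2) (v 3),
        dist (v 0) (v 1) * dist (v 0) (v 3) * dist (v 1) (v 3),
        dist (v 0) (v 1) * dist (v 0) (v 2) * dist (v 1) (v 2)] := ⟨_, rfl⟩
  have hw0 : ∀ i, 0 < w i := by
    intro i
    rw [hw]
    fin_cases i <;> simp <;> positivity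
  have hsub := interior_convexHull_subset_H3 (V := range v) (by rintro _ ⟨i, rfl⟩; exact (hv i).le)
  have hae := idealHull_ae_eq_interior (V := range v) (by rintro _ ⟨i, rfl⟩; exact (hv i).le)
  have hH : idealHull (range v) ∩ H3 = idealHull (range v) := by
    rw [idealHull, inter_assoc, inter_self]
  let D : ℝ → ℝ → ℝ → ℝ := fun y0 y1 y2 =>
    (p + q * y0 + r * y1) * y2 + (p * (y0 * y1) + q * y1 + r * y0)
  have step : ∀ y ∈ {y : E3 | ∀ i, 0 < y i},
      ENNReal.ofReal |(simplexParamDeriv v w y).det| *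
        ENNReal.ofReal ((1 - ‖simplexParam v w y‖ ^ 2) ^ 2)⁻¹ =
      ENNReal.ofReal |(vertexMatrix v).det| *
        ENNReal.ofReal (1 / D (y 0) (y 1) (y 2) ^ 2) := by
    intro y hy
    have h0 := hy 0
    have h1 := hy 1
    have h2 := hy 2
    have hm := sum_homCoord_pos hw0 hy
    have hD : 0 < D (y 0) (y 1) (y 2) := by simp only [D]; positivity
    rw [← ENNReal.ofReal_mul (abs_nonneg _), ← ENNReal.ofReal_mul (abs_nonneg _),
      abs_det_simplexParamDeriv v hw0 hy]
    congr 1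
    have hB := sum_sq_mul_one_sub_norm_simplexParam hv hw0 hy
    generalize 1 - ‖simplexParam v w y‖ ^ 2 = b at hB ⊢
    generalize ∑ i, w i * homCoord y i = m at hm hB ⊢
    obtain ⟨P, hP⟩ : ∃ P, P = dist (v 0) (v 1) * dist (v 0) (v 2) * dist (v 0) (v 3) *
      dist (v 1) (v 2) * dist (v 1) (v 3) * dist (v 2) (v 3) := ⟨_, rfl⟩
    have hP0 : 0 < P := by rw [hP]; positivity
    have hB' : m ^ 2 * b = P * D (y 0) (y 1) (y 2) := by
      rw [hB, hw, hP]
      simp [D, hp, hq, hr, edgeProd]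
      ring
    have hW : w 0 * w 1 * w 2 * w 3 = P ^ 2 := by
      rw [hw, hP]
      simp
      ring
    have hb : 0 < b := by
      have : 0 < m ^ 2 * b := by rw [hB']; positivity
      exact pos_of_mul_pos_right this (by positivity)
    generalize D (y 0) (y 1) (y 2) = d at hD hB' ⊢
    rw [hW]
    have : P ^ 2 * d ^ 2 = m ^ 4 * b ^ 2 := by
      rw [← mul_pow, ← hB']; ring
    field_simp
    linear_combination this
  have hF : Measurable fun u : (ℝ × ℝ) × ℝ => ENNReal.ofReal (1 / D u.1.1 u.1.2 u.2 ^ 2) := by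
    simp only [D]; fun_prop
  rw [hypVolume, hH, setLIntegral_congr hae, setLIntegral_congr_fun isOpen_interior.measurableSet
      (fun x hx => congrArg ENNReal.ofReal (sqrt_det_kleinMetric (hsub hx))),
    ← simplexParam_image h hw0,
    lintegral_image_eq_lintegral_abs_det_fderiv_mul volume measurableSet_octant
      (fun y hy => (hasFDerivAt_simplexParam v hw0 hy).hasFDerivWithinAt)
      (simplexParam_injOn h hw0),
    setLIntegral_congr_fun measurableSet_octant step,
    lintegral_const_mul' _ _ ENNReal.ofReal_ne_top,
    lintegral_octant (fun a b c => ENNReal.ofReal (1 / D a b c ^ 2)) hF]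
  congr 1
  refine setLIntegral_congr_fun (measurableSet_Ioi.prod measurableSet_Ioi) fun u hu => ?_
  have hy : 0 < u.1 := hu.1
  have hz : 0 < u.2 := hu.2
  exact lintegral_Ioi_one_div_sq (by positivity) (by positivity)

/-- The volume of a regular ideal tetrahedron, as an integral. -/
noncomputable def regularVolume : ENNReal := ENNReal.ofReal (√3 / 4) * linkIntegral 1 1 1

theorem regularVolume_lt_top : regularVolume < ⊤ :=
  ENNReal.mul_lt_top ENNReal.ofReal_lt_top linkIntegral_one_lt_top

theorem heron_edgeProd {v : Fin 4 → E3} (hv : ∀ i, ‖v i‖ = 1) :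
    heron (edgeProd v 0 1 2 3) (edgeProd v 0 2 1 3) (edgeProd v 0 3 1 2) =
      16 * (vertexMatrix v).det ^ 2 := (sixteen_mul_vertexMatrix_det_sq hv).symm

theorem abs_vertexMatrix_det {v : Fin 4 → E3} (hv : ∀ i, ‖v i‖ = 1) : |(vertexMatrix v).det| =
    √(heron (edgeProd v 0 1 2 3) (edgeProd v 0 2 1 3) (edgeProd v 0 3 1 2)) / 4 := by
  rw [heron_edgeProd hv, Real.sqrt_mul (by norm_num), Real.sqrt_sq_eq_abs,
    show (16 : ℝ) = 4 ^ 2 by norm_num, Real.sqrt_sq (by norm_num)]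
  ring

theorem heron_self (p : ℝ) : heron p p p = 3 * (p ^ 2) ^ 2 := by unfold heron; ring

theorem vertexMatrix_det_ne_zero_of_regular {v : Fin 4 → E3} (hv : ∀ i, ‖v i‖ = 1)
    (h0 : edgeProd v 0 1 2 3 ≠ 0) (h1 : edgeProd v 0 2 1 3 = edgeProd v 0 1 2 3)
    (h2 : edgeProd v 0 3 1 2 = edgeProd v 0 1 2 3) : (vertexMatrix v).det ≠ 0 := by
  have := heron_edgeProd hv
  rw [h1, h2, heron_self] at this
  intro h
  rw [h] at this
  have : 0 < (edgeProd v 0 1 2 3 ^ 2) ^ 2 := by positivity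
  linarith

/-- An ideal tetrahedron whose three products of lengths of opposite edges agree has the volume of
the regular one. -/
theorem hypVolume_of_regular {v : Fin 4 → E3} (hv : ∀ i, ‖v i‖ = 1)
    (h0 : edgeProd v 0 1 2 3 ≠ 0) (h1 : edgeProd v 0 2 1 3 = edgeProd v 0 1 2 3)
    (h2 : edgeProd v 0 3 1 2 = edgeProd v 0 1 2 3) :
    hypVolume (idealHull (range v)) = regularVolume := by
  have hp : 0 < edgeProd v 0 1 2 3 :=
    lt_of_le_of_ne (mul_nonneg dist_nonneg dist_nonneg) h0.symm
  rw [hypVolume_idealHull_range hv (vertexMatrix_det_ne_zero_of_regular hv h0 h1 h2),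
    abs_vertexMatrix_det hv, h1, h2, linkIntegral_self hp, ← mul_assoc,
    ← ENNReal.ofReal_mul (by positivity), regularVolume]
  congr 2
  rw [heron_self, Real.sqrt_mul (by norm_num), Real.sqrt_sq (by positivity)]
  field_simp

/-- Among all ideal tetrahedra the regular one has the largest volume. The volume is averaged over
three labellings of the vertices. -/
theorem hypVolume_idealHull_range_le {v : Fin 4 → E3} (hv : ∀ i, ‖v i‖ = 1)
    (h : (vertexMatrix v).det ≠ 0) : hypVolume (idealHull (range v)) ≤ regularVolume := by
  have hpos : ∀ i j, i ≠ j → 0 < dist (v i) (v j) :=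
    fun i j hij => dist_pos.2 fun e => hij (vertexMatrix_injective h e)
  have hp : 0 < edgeProd v 0 1 2 3 := mul_pos (hpos _ _ (by decide)) (hpos _ _ (by decide))
  have hq : 0 < edgeProd v 0 2 1 3 := mul_pos (hpos _ _ (by decide)) (hpos _ _ (by decide))
  have hr : 0 < edgeProd v 0 3 1 2 := mul_pos (hpos _ _ (by decide)) (hpos _ _ (by decide))
  have hh : 0 < heron (edgeProd v 0 1 2 3) (edgeProd v 0 2 1 3) (edgeProd v 0 3 1 2) := by
    rw [heron_edgeProd hv]; positivity
  have main := sqrt_heron_mul_linkIntegral_le hp hq hr hh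
  have relabel : ∀ u : Fin 4 → E3, range u = range v → ∀ p q r, p = edgeProd u 0 1 2 3 →
      q = edgeProd u 0 2 1 3 → r = edgeProd u 0 3 1 2 → heron p q r =
        heron (edgeProd v 0 1 2 3) (edgeProd v 0 2 1 3) (edgeProd v 0 3 1 2) →
      hypVolume (idealHull (range v)) = ENNReal.ofReal (√(heron (edgeProd v 0 1 2 3)
        (edgeProd v 0 2 1 3) (edgeProd v 0 3 1 2)) / 4) * linkIntegral p q r := by
    rintro u hu p q r rfl rfl rfl hσ
    have hvu : ∀ i, ‖u i‖ = 1 := fun i => by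
      obtain ⟨j, hj⟩ : u i ∈ range v := hu ▸ mem_range_self i
      rw [← hj, hv]
    have hd : (vertexMatrix u).det ≠ 0 := by
      intro h0
      have := heron_edgeProd hvu
      rw [hσ, h0] at this
      linarith
    rw [← hu, hypVolume_idealHull_range hvu hd, abs_vertexMatrix_det hvu, hσ]
  have range4 : ∀ u : Fin 4 → E3, range u = {u 0, u 1, u 2, u 3} := by
    intro u
    ext x
    simp [Fin.exists_fin_succ, eq_comm]
  have s : ∀ i j, dist (v i) (v j) = dist (v j) (v i) := fun i j => dist_comm _ _
  have r1 := relabel v rfl _ _ _ rfl rfl rfl rfl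
  have r2 := relabel ![v 2, v 0, v 1, v 3] (by
      rw [range4, range4]
      ext x
      simp only [Matrix.cons_val, mem_insert_iff, mem_singleton_iff]
      tauto)
    (edgeProd v 0 2 1 3) (edgeProd v 0 3 1 2) (edgeProd v 0 1 2 3)
    (by simp [edgeProd, s 2 0]) (by simp [edgeProd, s 2 1, mul_comm])
    (by simp [edgeProd, mul_comm]) (by unfold heron; ring)
  have r3 := relabel ![v 1, v 2, v 0, v 3] (by
      rw [range4, range4]
      ext x
      simp only [Matrix.cons_val, mem_insert_iff, mem_singleton_iff]
      tauto)
    (edgeProd v 0 3 1 2) (edgeProd v 0 1 2 3) (edgeProd v 0 2 1 3)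
    (by simp [edgeProd, mul_comm]) (by simp [edgeProd, s 1 0])
    (by simp [edgeProd, s 2 0, mul_comm]) (by unfold heron; ring)
  have e : ∀ x : ℝ, 0 ≤ x → ENNReal.ofReal (x / 4) = ENNReal.ofReal (1 / 4) * ENNReal.ofReal x := by
    intro x hx
    rw [← ENNReal.ofReal_mul (by norm_num)]
    congr 1
    ring
  have hsum : 3 * hypVolume (idealHull (range v)) ≤ 3 * regularVolume := by
    calc 3 * hypVolume (idealHull (range v)) = hypVolume (idealHull (range v)) +
          hypVolume (idealHull (range v)) + hypVolume (idealHull (range v)) := by ring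
      _ = ENNReal.ofReal (1 / 4) * (ENNReal.ofReal √(heron (edgeProd v 0 1 2 3)
            (edgeProd v 0 2 1 3) (edgeProd v 0 3 1 2)) * _) := by
          nth_rewrite 1 [r1]
          nth_rewrite 1 [r2]
          rw [r3, e _ (Real.sqrt_nonneg _), ← mul_add, ← mul_add, mul_assoc]
      _ ≤ ENNReal.ofReal (1 / 4) * (3 * (ENNReal.ofReal √3 * linkIntegral 1 1 1)) := by gcongr
      _ = 3 * regularVolume := by
          rw [regularVolume, e _ (Real.sqrt_nonneg _)]
          ring
  exact (ENNReal.mul_le_mul_iff_right (by norm_num) (by norm_num)).1 hsum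

/-! ### Cutting a cube into five tetrahedra -/

/-- A point of the unit sphere is an extreme point of every set of points of the sphere. -/
theorem mem_of_mem_convexHull_sphere {V : Set E3} (hV : V ⊆ Metric.sphere 0 1) {x : E3}
    (hx : ‖x‖ = 1) (h : x ∈ convexHull ℝ V) : x ∈ V := by
  by_contra hxV
  have hc : Convex ℝ {y : E3 | ⟪x, y⟫ < 1} := convex_halfSpace_lt (innerₛₗ ℝ x).isLinear 1
  have hsub : V ⊆ {y : E3 | ⟪x, y⟫ < 1} := fun y hy => by
    have hy1 : ‖y‖ = 1 := by simpa using hV hy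
    exact (inner_lt_one_iff_real_of_norm_eq_one hx hy1).2 fun e => hxV (e ▸ hy)
  have := convexHull_min hsub hc h
  rw [mem_ofPred_eq, real_inner_self_eq_norm_sq, hx] at this
  norm_num at this

theorem AffineMap.map_sum_smul {ι : Type*} [Fintype ι] (g : E3 →ᵃ[ℝ] ℝ) (c : ι → ℝ) (v : ι → E3) :
    ∑ i, c i * g (v i) = g.linear (∑ i, c i • v i) + (∑ i, c i) * g 0 := by
  have e : ∀ x, g x = g.linear x + g 0 := fun x => congrFun g.decomp x
  simp only [e (v _), mul_add, Finset.sum_add_distrib, map_sum, map_smul, smul_eq_mul,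
    Finset.sum_mul]

/-- Four points that are separated by affine functions dual to them are affinely independent. -/
theorem vertexMatrix_det_ne_zero_of_dual {v : Fin 4 → E3} {g : Fin 4 → E3 →ᵃ[ℝ] ℝ}
    (h0 : ∀ i j, i ≠ j → g i (v j) = 0) (h1 : ∀ i, 0 < g i (v i)) :
    (vertexMatrix v).det ≠ 0 := by
  intro h
  obtain ⟨c, hc, hcN⟩ := Matrix.exists_vecMul_eq_zero_iff.2 h
  have e : ∀ j, ∑ i, c i * vertexMatrix v i j = 0 := fun j => congrFun hcN j
  have hs : ∑ i, c i = 0 := by simpa [vertexMatrix] using e 0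
  have hv : ∑ i, c i • v i = 0 := by
    ext k
    fin_cases k
    · simpa [vertexMatrix] using e 1
    · simpa [vertexMatrix] using e 2
    · simpa [vertexMatrix] using e 3
  refine hc (funext fun j => ?_)
  have := (g j).map_sum_smul c v
  rw [hv, hs, map_zero, zero_mul, add_zero, Finset.sum_eq_single j
    (fun i _ hij => by rw [h0 j i hij.symm, mul_zero]) (by simp)] at this
  exact (mul_eq_zero.1 this).resolve_right (h1 j).ne'

/-- The dual affine functions are positive multiples of the barycentric coordinates. -/
theorem mem_convexHull_of_dual {v : Fin 4 → E3} {g : Fin 4 → E3 →ᵃ[ℝ] ℝ}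
    (h0 : ∀ i j, i ≠ j → g i (v j) = 0) (h1 : ∀ i, 0 < g i (v i)) {x : E3}
    (hx : ∀ i, 0 ≤ g i x) : x ∈ convexHull ℝ (range v) := by
  let b := vertexBasis v (vertexMatrix_det_ne_zero_of_dual h0 h1)
  have hb : convexHull ℝ (range v) = {x | ∀ i, 0 ≤ b.coord i x} := b.convexHull_eq_nonneg_coord
  rw [hb]
  intro j
  have := (g j).map_sum_smul (fun i => b.coord i x) v
  have e : ∑ i, b.coord i x • v i = x := b.linear_combination_coord_eq_self x
  rw [e, b.sum_coord_apply_eq_one, one_mul,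
    ← show g j x = (g j).linear x + g j 0 from congrFun (g j).decomp x,
    Finset.sum_eq_single j
    (fun i _ hij => by rw [h0 j i hij.symm, mul_zero]) (by simp)] at this
  have h2 := hx j
  rw [← this] at h2
  exact nonneg_of_mul_nonneg_left h2 (h1 j)

/-- Vertices of the combinatorial cube. -/
abbrev CubeVertex : Type := Fin 3 → Bool

/-- The neighbour of a vertex of the cube in direction `k`. -/
def flipAt (k : Fin 3) (s : CubeVertex) : CubeVertex := Function.update s k (!s k)

/-- Four pairwise non-adjacent vertices of the cube, those with an odd number of entries `true`. -/
def evenVertex : Fin 4 → CubeVertex :=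
  ![![true, true, true], ![true, false, false], ![false, true, false], ![false, false, true]]

/-- The vertices opposite to the `evenVertex i`. -/
def oddVertex (i : Fin 4) : CubeVertex := fun k => !evenVertex i k

/-- A vertex of the cube together with its three neighbours. -/
def corner (o : CubeVertex) : Fin 4 → CubeVertex := ![flipAt 0 o, flipAt 1 o, flipAt 2 o, o]

/-- A convex set `K` having ideal points `v s` arranged as the vertices of a cube: the facet in
direction `k` on the side `ε` lies in the plane where the affine function `f k ε`, which is
nonnegative on `K`, vanishes. -/
structure CubeConfig (K : Set E3) where
  convex : Convex ℝ K
  v : CubeVertex → E3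
  f : Fin 3 → Bool → E3 →ᵃ[ℝ] ℝ
  norm_v : ∀ s, ‖v s‖ = 1
  v_mem : ∀ s, v s ∈ K
  f_nonneg : ∀ k ε, ∀ x ∈ K, 0 ≤ f k ε x
  f_v : ∀ k ε s, f k ε (v s) = 0 ↔ s k = ε

namespace CubeConfig

variable {K : Set E3} (c : CubeConfig K)

theorem v_injective : Function.Injective c.v := fun s t h => by
  funext k
  have := (c.f_v k (t k) s).1 (by rw [h]; exact (c.f_v k (t k) t).2 rfl)
  exact this

/-- The affine function that vanishes at the three neighbours of `v o` and is `-1` at `v o`. -/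
noncomputable def cut (o : CubeVertex) : E3 →ᵃ[ℝ] ℝ :=
  ∑ k, (c.f k (o k) (c.v (flipAt k o)))⁻¹ • c.f k (o k) - AffineMap.const ℝ E3 1

theorem cut_apply (o : CubeVertex) (x : E3) :
    c.cut o x = ∑ k, (c.f k (o k) (c.v (flipAt k o)))⁻¹ * c.f k (o k) x - 1 := by
  simp [cut, Fin.sum_univ_three]

theorem f_flipAt_pos (o : CubeVertex) (k : Fin 3) : 0 < c.f k (o k) (c.v (flipAt k o)) := by
  refine lt_of_le_of_ne (c.f_nonneg _ _ _ (c.v_mem _)) fun h => ?_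
  have := (c.f_v k (o k) (flipAt k o)).1 h.symm
  simp [flipAt] at this

theorem f_flipAt_eq_zero (o : CubeVertex) {k l : Fin 3} (h : k ≠ l) :
    c.f k (o k) (c.v (flipAt l o)) = 0 :=
  (c.f_v _ _ _).2 (by simp [flipAt, Function.update_of_ne h])

theorem cut_self (o : CubeVertex) : c.cut o (c.v o) = -1 := by
  rw [cut_apply, Finset.sum_eq_zero, zero_sub]
  intro k _
  rw [(c.f_v k (o k) o).2 rfl, mul_zero]

theorem cut_flipAt (o : CubeVertex) (l : Fin 3) : c.cut o (c.v (flipAt l o)) = 0 := by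
  rw [cut_apply, Finset.sum_eq_single l, inv_mul_cancel₀ (c.f_flipAt_pos o l).ne', sub_self]
  · intro k _ hk
    rw [c.f_flipAt_eq_zero o hk, mul_zero]
  · simp

/-- The affine functions dual to the vertices of a corner tetrahedron. -/
noncomputable def cornerDual (o : CubeVertex) : Fin 4 → E3 →ᵃ[ℝ] ℝ :=
  ![c.f 0 (o 0), c.f 1 (o 1), c.f 2 (o 2), -c.cut o]

theorem cornerDual_eq_zero (o : CubeVertex) (i j : Fin 4) (h : i ≠ j) :
    c.cornerDual o i (c.v (corner o j)) = 0 := by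
  have h1 : ∀ k, c.f k (o k) (c.v o) = 0 := fun k => (c.f_v _ _ _).2 rfl
  fin_cases i <;> fin_cases j <;> first | exact absurd rfl h | skip
  all_goals simp [cornerDual, corner, cut_flipAt, h1]
  all_goals exact c.f_flipAt_eq_zero o (by decide)

theorem cornerDual_pos (o : CubeVertex) (i : Fin 4) :
    0 < c.cornerDual o i (c.v (corner o i)) := by
  fin_cases i
  all_goals simp [cornerDual, corner, cut_self]
  all_goals exact c.f_flipAt_pos o _

theorem mem_corner_of_cut_nonpos (o : CubeVertex) {x : E3} (hx : x ∈ K) (h : c.cut o x ≤ 0) :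
    x ∈ convexHull ℝ (range (c.v ∘ corner o)) := by
  refine mem_convexHull_of_dual (v := c.v ∘ corner o) (c.cornerDual_eq_zero o) (c.cornerDual_pos o)
    fun i => ?_
  fin_cases i
  · exact c.f_nonneg _ _ _ hx
  · exact c.f_nonneg _ _ _ hx
  · exact c.f_nonneg _ _ _ hx
  · simpa [cornerDual] using h

/-- Vertices away from the corner at `o` lie strictly beyond the plane cutting it off, since they
are extreme points. -/
theorem cut_pos (o s : CubeVertex) (h : s ∉ range (corner o)) : 0 < c.cut o (c.v s) := by
  by_contra! hs
  have := mem_of_mem_convexHull_sphere (by rintro _ ⟨i, rfl⟩; simp [c.norm_v]) (c.norm_v s)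
    (c.mem_corner_of_cut_nonpos o (c.v_mem s) hs)
  rw [range_comp] at this
  obtain ⟨t, ht, hts⟩ := this
  exact h (c.v_injective hts ▸ ht)

/-- The cutting plane separates `v o` from all other vertices. -/
theorem cut_nonneg (o s : CubeVertex) (h : s ≠ o) : 0 ≤ c.cut o (c.v s) := by
  by_cases hs : s ∈ range (corner o)
  · obtain ⟨i, rfl⟩ := hs
    fin_cases i
    · exact (c.cut_flipAt o 0).ge
    · exact (c.cut_flipAt o 1).ge
    · exact (c.cut_flipAt o 2).ge
    · exact absurd rfl h
  · exact (c.cut_pos o s hs).le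

theorem cut_even_eq_zero (i j : Fin 4) (h : i ≠ j) :
    c.cut (oddVertex i) (c.v (evenVertex j)) = 0 := by
  have : ∀ i j, i ≠ j → ∃ k, evenVertex j = flipAt k (oddVertex i) := by decide
  obtain ⟨k, hk⟩ := this i j h
  rw [hk, cut_flipAt]

theorem cut_even_pos (i : Fin 4) : 0 < c.cut (oddVertex i) (c.v (evenVertex i)) := by
  refine c.cut_pos _ _ ?_
  have : ∀ i j, corner (oddVertex i) j ≠ evenVertex i := by decide
  rintro ⟨j, hj⟩
  exact this i j hj

/-- The five tetrahedra into which a cube is cut: the central one and the four corners. -/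
def tet : Option (Fin 4) → Fin 4 → E3
  | none => c.v ∘ evenVertex
  | some i => c.v ∘ corner (oddVertex i)

theorem norm_tet (a : Option (Fin 4)) (i : Fin 4) : ‖c.tet a i‖ = 1 := by
  cases a <;> exact c.norm_v _

theorem tet_mem (a : Option (Fin 4)) (i : Fin 4) : c.tet a i ∈ K := by
  cases a <;> exact c.v_mem _

theorem tet_det_ne_zero (a : Option (Fin 4)) : (vertexMatrix (c.tet a)).det ≠ 0 := by
  cases a with
  | none =>
    exact vertexMatrix_det_ne_zero_of_dual (v := c.v ∘ evenVertex)
      (g := fun i => c.cut (oddVertex i)) c.cut_even_eq_zero c.cut_even_pos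
  | some i =>
    exact vertexMatrix_det_ne_zero_of_dual (v := c.v ∘ corner (oddVertex i))
      (c.cornerDual_eq_zero _) (c.cornerDual_pos _)

/-- A point of `K` that no cutting plane puts in a corner has nonnegative barycentric coordinates in
the central tetrahedron. -/
theorem iUnion_convexHull_tet : ⋃ a, convexHull ℝ (range (c.tet a)) = K := by
  refine Subset.antisymm (iUnion_subset fun a => convexHull_min ?_ c.convex) fun x hx => ?_
  · rintro _ ⟨i, rfl⟩
    exact c.tet_mem a i
  · by_cases h : ∃ i, c.cut (oddVertex i) x ≤ 0
    · obtain ⟨i, hi⟩ := h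
      exact mem_iUnion.2 ⟨some i, c.mem_corner_of_cut_nonpos _ hx hi⟩
    · push Not at h
      exact mem_iUnion.2 ⟨none, mem_convexHull_of_dual (v := c.v ∘ evenVertex)
        (g := fun i => c.cut (oddVertex i)) c.cut_even_eq_zero c.cut_even_pos fun i => (h i).le⟩

theorem cut_nonpos_of_mem_corner (i : Fin 4) {x : E3}
    (hx : x ∈ convexHull ℝ (range (c.tet (some i)))) : c.cut (oddVertex i) x ≤ 0 := by
  have hc : Convex ℝ (c.cut (oddVertex i) ⁻¹' Iic 0) := (convex_Iic 0).affine_preimage _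
  refine convexHull_min ?_ hc hx
  rintro _ ⟨j, rfl⟩
  change c.cut (oddVertex i) (c.v (corner (oddVertex i) j)) ≤ 0
  fin_cases j
  · exact (c.cut_flipAt _ 0).le
  · exact (c.cut_flipAt _ 1).le
  · exact (c.cut_flipAt _ 2).le
  · exact (c.cut_self _).trans_le (by norm_num)

theorem cut_nonneg_of_mem_tet (i : Fin 4) {a : Option (Fin 4)} (ha : a ≠ some i) {x : E3}
    (hx : x ∈ convexHull ℝ (range (c.tet a))) : 0 ≤ c.cut (oddVertex i) x := by
  have hc : Convex ℝ (c.cut (oddVertex i) ⁻¹' Ici 0) := (convex_Ici 0).affine_preimage _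
  refine convexHull_min ?_ hc hx
  rintro _ ⟨j, rfl⟩
  cases a with
  | none =>
    refine c.cut_nonneg _ (evenVertex j) ?_
    have : ∀ i j, evenVertex j ≠ oddVertex i := by decide
    exact this i j
  | some l =>
    refine c.cut_nonneg _ (corner (oddVertex l) j) ?_
    have : ∀ i l j, l ≠ i → corner (oddVertex l) j ≠ oddVertex i := by decide
    exact this i l j fun h => ha (congrArg some h)

theorem volume_cut_eq_zero (o : CubeVertex) : volume {x | c.cut o x = 0} = 0 := by
  let S : AffineSubspace ℝ E3 := (affineSpan ℝ {0}).comap (c.cut o)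
  have hS : (S : Set E3) = {x | c.cut o x = 0} := by
    ext x
    simp [S]
  rw [← hS]
  refine Measure.addHaar_affineSubspace _ _ fun h => ?_
  have : c.v o ∈ (S : Set E3) := by rw [h]; trivial
  rw [hS, mem_ofPred_eq, cut_self] at this
  norm_num at this

theorem volume_tet_inter {a b : Option (Fin 4)} (h : a ≠ b) :
    volume (convexHull ℝ (range (c.tet a)) ∩ convexHull ℝ (range (c.tet b))) = 0 := by
  rcases a with _ | i
  · rcases b with _ | j
    · exact absurd rfl h
    · exact measure_mono_null (fun x hx => le_antisymm (c.cut_nonpos_of_mem_corner j hx.2)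
        (c.cut_nonneg_of_mem_tet j h hx.1)) (c.volume_cut_eq_zero (oddVertex j))
  · exact measure_mono_null (fun x hx => le_antisymm (c.cut_nonpos_of_mem_corner i hx.1)
        (c.cut_nonneg_of_mem_tet i h.symm hx.2)) (c.volume_cut_eq_zero (oddVertex i))

/-- The volume of a polyhedron of cube type is the sum of the volumes of its five tetrahedra. -/
theorem hypVolume_eq_sum :
    hypVolume (K ∩ H3) = ∑ a, hypVolume (idealHull (range (c.tet a))) := by
  let μ : Measure E3 := volume.withDensity fun x => ENNReal.ofReal √(kleinMetric x).det
  have hμ : ∀ S, hypVolume (S ∩ H3) = μ (S ∩ H3) := fun S => by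
    rw [hypVolume, inter_assoc, inter_self, withDensity_apply']
  have hac : μ ≪ volume := withDensity_absolutelyContinuous _ _
  simp only [idealHull, hμ]
  have hK : K ∩ H3 = ⋃ a, convexHull ℝ (range (c.tet a)) ∩ H3 := by
    rw [← iUnion_inter, c.iUnion_convexHull_tet]
  rw [hK, measure_iUnion₀, tsum_fintype]
  · intro a b hab
    refine measure_mono_null ?_ (hac (c.volume_tet_inter hab))
    exact inter_subset_inter inter_subset_left inter_subset_left
  · intro a
    exact (((convex_convexHull ℝ _).inter (convex_ball 0 1)).nullMeasurableSet _).mono_ac hac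

theorem hypVolume_le (c : CubeConfig K) : hypVolume (K ∩ H3) ≤ 5 * regularVolume := by
  rw [c.hypVolume_eq_sum]
  calc _ ≤ ∑ _a : Option (Fin 4), regularVolume :=
        Finset.sum_le_sum fun a _ =>
          hypVolume_idealHull_range_le (c.norm_tet a) (c.tet_det_ne_zero a)
    _ = _ := by simp

end CubeConfig

/-! ### From the face lattice to the vertices and facets of a cube -/

theorem norm_of_mem_sphere {V : Set E3} (hV : V ⊆ Metric.sphere 0 1) {x : E3} (hx : x ∈ V) :
    ‖x‖ = 1 := by simpa using hV hx

/-- Taking the closure adds exactly the ideal vertices. -/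
theorem closure_idealHull {V : Set E3} (hf : V.Finite) (hV : V ⊆ Metric.sphere 0 1)
    (ht : affineSpan ℝ V = ⊤) : closure (idealHull V) = convexHull ℝ V := by
  have hn : ∀ x ∈ V, ‖x‖ ≤ 1 := fun x hx => (norm_of_mem_sphere hV hx).le
  have hcl : IsClosed (convexHull ℝ V) := hf.isClosed_convexHull ℝ
  refine Subset.antisymm (closure_minimal inter_subset_left hcl) ?_
  have hi : (interior (convexHull ℝ V)).Nonempty :=
    interior_convexHull_nonempty_iff_affineSpan_eq_top.2 ht
  calc convexHull ℝ V = closure (convexHull ℝ V) := hcl.closure_eq.symm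
    _ = closure (interior (convexHull ℝ V)) :=
        ((convex_convexHull ℝ V).closure_interior_eq_closure_of_nonempty_interior hi).symm
    _ ⊆ closure (idealHull V) := closure_mono <| subset_inter interior_subset
        (interior_convexHull_subset_H3 hn)

/-- The coordinate `±1` of the cube `[-1, 1]³` encoded by a Boolean. -/
def boolSign (ε : Bool) : ℝ := if ε then 1 else -1

theorem boolSign_mul_self (ε : Bool) : boolSign ε * boolSign ε = 1 := by
  cases ε <;> simp [boolSign]

theorem abs_boolSign (ε : Bool) : |boolSign ε| = 1 := by cases ε <;> simp [boolSign]

theorem boolSign_injective : Function.Injective boolSign := by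
  intro a b h
  cases a <;> cases b <;> simp [boolSign] at h ⊢ <;> norm_num at h

/-- The vertices of the cube `[-1, 1]³`. -/
noncomputable def cubePoint (s : CubeVertex) : E3 := WithLp.toLp 2 fun k => boolSign (s k)

@[simp] theorem cubePoint_apply (s : CubeVertex) (k : Fin 3) : cubePoint s k = boolSign (s k) := rfl

theorem cubePoint_mem (s : CubeVertex) : cubePoint s ∈ euclideanCube := fun k => by
  rw [cubePoint_apply, abs_boolSign]

theorem boolSign_mul_le {x : E3} (hx : x ∈ euclideanCube) (k : Fin 3) (ε : Bool) :
    boolSign ε * x k ≤ 1 := by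
  calc _ ≤ |boolSign ε * x k| := le_abs_self _
    _ = |x k| := by rw [abs_mul, abs_boolSign, one_mul]
    _ ≤ 1 := hx k

theorem isExposed_singleton_cubePoint (s : CubeVertex) :
    IsExposed ℝ euclideanCube {cubePoint s} := by
  intro _
  let l : E3 →L[ℝ] ℝ := ∑ k, boolSign (s k) • EuclideanSpace.proj k
  have hl : ∀ x, l x = ∑ k, boolSign (s k) * x k := fun x => by simp [l]
  have hs : l (cubePoint s) = ∑ k : Fin 3, 1 := by simp [hl, boolSign_mul_self]
  have hle : ∀ x ∈ euclideanCube, l x ≤ l (cubePoint s) := fun x hx => by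
    rw [hl, hs]
    exact_mod_cast Finset.sum_le_sum fun k _ => boolSign_mul_le hx k (s k)
  refine ⟨l, Subset.antisymm ?_ ?_⟩
  · rintro _ rfl
    exact ⟨cubePoint_mem s, hle⟩
  · rintro x ⟨hx, hmax⟩
    have h1 : l x = l (cubePoint s) := le_antisymm (hle x hx) (hmax _ (cubePoint_mem s))
    rw [hl, hs] at h1
    push_cast at h1
    have h2 := (Finset.sum_eq_sum_iff_of_le fun k _ => boolSign_mul_le hx k (s k)).1 h1
    ext k
    have h3 := congrArg (boolSign (s k) * ·) (h2 k (Finset.mem_univ k))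
    simpa [← mul_assoc, boolSign_mul_self] using h3

theorem isExposed_cube_facet (k : Fin 3) (ε : Bool) :
    IsExposed ℝ euclideanCube {x ∈ euclideanCube | x k = boolSign ε} := by
  intro _
  have hp : ∀ x : E3, (boolSign ε • EuclideanSpace.proj k : E3 →L[ℝ] ℝ) x = boolSign ε * x k :=
    fun x => by simp
  refine ⟨boolSign ε • EuclideanSpace.proj k, ?_⟩
  ext x
  simp only [hp]
  refine and_congr_right fun hx => ⟨fun h y hy => ?_, fun h => ?_⟩
  · rw [h, boolSign_mul_self]
    exact boolSign_mul_le hy k ε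
  · have h1 := h _ (cubePoint_mem fun _ => ε)
    rw [cubePoint_apply, boolSign_mul_self] at h1
    have h2 := le_antisymm (boolSign_mul_le hx k ε) h1
    have h3 := congrArg (boolSign ε * ·) h2
    simpa [← mul_assoc, boolSign_mul_self] using h3

theorem isExposed_singleton_of_mem_sphere {V : Set E3} (hV : V ⊆ Metric.sphere 0 1) {v : E3}
    (hv : v ∈ V) : IsExposed ℝ (convexHull ℝ V) {v} := by
  intro _
  have hv1 := norm_of_mem_sphere hV hv
  have hsub := convexHull_subset_closedBall fun x hx => (norm_of_mem_sphere hV hx).le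
  have hle : ∀ x ∈ convexHull ℝ V, ⟪v, x⟫ ≤ 1 := fun x hx => by
    have hx1 : ‖x‖ ≤ 1 := by simpa using hsub hx
    calc _ ≤ ‖v‖ * ‖x‖ := real_inner_le_norm v x
      _ ≤ 1 := by rw [hv1, one_mul]; exact hx1
  have hvv : ⟪v, v⟫ = 1 := by rw [real_inner_self_eq_norm_sq, hv1, one_pow]
  refine ⟨innerSL ℝ v, Subset.antisymm ?_ ?_⟩
  · rintro _ rfl
    refine ⟨subset_convexHull ℝ V hv, fun y hy => ?_⟩
    simpa only [innerSL_apply_apply, hvv] using hle y hy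
  · rintro x ⟨hx, hmax⟩
    have h1 := hmax v (subset_convexHull ℝ V hv)
    simp only [innerSL_apply_apply, hvv] at h1
    have hx1 : ‖x‖ ≤ 1 := by simpa using hsub hx
    have h2 : ‖x - v‖ ^ 2 ≤ 0 := by
      rw [norm_sub_sq_real, hv1, real_inner_comm]
      nlinarith [norm_nonneg x]
    have h3 : ‖x - v‖ = 0 := by
      rw [← sq_eq_zero_iff]; exact le_antisymm h2 (sq_nonneg _)
    exact sub_eq_zero.1 (norm_eq_zero.1 h3)

/-- A nonempty exposed face of a polytope contains one of its vertices. -/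
theorem exists_mem_of_isExposed {V : Set E3} (hf : V.Finite) {F : Set E3}
    (hF : IsExposed ℝ (convexHull ℝ V) F) (hne : F.Nonempty) : ∃ v ∈ V, v ∈ F := by
  obtain ⟨l, rfl⟩ := hF hne
  obtain ⟨x, hx, -⟩ := hne
  have hVne : V.Nonempty := convexHull_nonempty_iff.1 ⟨x, hx⟩
  obtain ⟨v, hv, hmax⟩ := hf.exists_maximalFor l V hVne
  refine ⟨v, hv, subset_convexHull ℝ V hv, fun y hy => ?_⟩
  refine convexHull_min (fun w hw => ?_) (convex_halfSpace_le l.isLinear (l v)) hy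
  rcases le_total (l w) (l v) with h | h
  · exact h
  · exact hmax hw h

theorem faceLattice_orderIso_empty {K L : Set E3} (ψ : FaceLattice K ≃o FaceLattice L) :
    (ψ ⟨∅, isExposed_empty⟩).1 = ∅ := by
  have h : ψ ⟨∅, isExposed_empty⟩ ≤ ⟨∅, isExposed_empty⟩ := by
    rw [← ψ.symm.le_iff_le, ψ.symm_apply_apply]
    exact empty_subset _
  exact subset_empty_iff.1 h

theorem faceLattice_orderIso_nonempty {K L : Set E3} (ψ : FaceLattice K ≃o FaceLattice L)
    {F : FaceLattice K} (hF : F.1.Nonempty) : (ψ F).1.Nonempty := by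
  by_contra h
  rw [not_nonempty_iff_eq_empty, ← faceLattice_orderIso_empty ψ] at h
  have := ψ.injective (Subtype.ext h)
  rw [this] at hF
  exact not_nonempty_empty hF

/-- The combinatorial type determines the arrangement of vertices and facets: the lattice
isomorphism matches the minimal nonempty faces, which are the vertices, and pulls the facets of the
cube back to faces containing the corresponding vertices. -/
theorem exists_cubeConfig {V : Set E3} (hf : V.Finite) (hV : V ⊆ Metric.sphere 0 1)
    (ψ : FaceLattice (convexHull ℝ V) ≃o FaceLattice euclideanCube) :
    Nonempty (CubeConfig (convexHull ℝ V)) := by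
  have hvert : ∀ s : CubeVertex, ∃ v, ∃ hv : v ∈ V,
      (ψ ⟨{v}, isExposed_singleton_of_mem_sphere hV hv⟩).1 = {cubePoint s} := by
    intro s
    obtain ⟨v, hv, hvF⟩ := exists_mem_of_isExposed hf
      (ψ.symm ⟨{cubePoint s}, isExposed_singleton_cubePoint s⟩).2
      (faceLattice_orderIso_nonempty ψ.symm (singleton_nonempty _))
    refine ⟨v, hv, ?_⟩
    have hle : (⟨{v}, isExposed_singleton_of_mem_sphere hV hv⟩ : FaceLattice (convexHull ℝ V)) ≤
        ψ.symm ⟨{cubePoint s}, isExposed_singleton_cubePoint s⟩ := singleton_subset_iff.2 hvF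
    rw [← ψ.le_iff_le, ψ.apply_symm_apply] at hle
    exact (faceLattice_orderIso_nonempty ψ (singleton_nonempty v)).subset_singleton_iff.1 hle
  choose v hv hψ using hvert
  have hK : ∀ s, v s ∈ convexHull ℝ V := fun s => subset_convexHull ℝ V (hv s)
  have hfacet : ∀ k ε, ∃ f : E3 →ᵃ[ℝ] ℝ, (∀ x ∈ convexHull ℝ V, 0 ≤ f x) ∧
      ∀ s, f (v s) = 0 ↔ s k = ε := by
    intro k ε
    obtain ⟨G, hG⟩ : ∃ G, G = ψ.symm ⟨_, isExposed_cube_facet k ε⟩ := ⟨_, rfl⟩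
    have hmem : ∀ s, v s ∈ G.1 ↔ s k = ε := by
      intro s
      have h1 : v s ∈ G.1 ↔ (⟨{v s}, isExposed_singleton_of_mem_sphere hV (hv s)⟩ :
          FaceLattice (convexHull ℝ V)) ≤ G := singleton_subset_iff.symm
      rw [h1, hG, ← ψ.le_iff_le, ψ.apply_symm_apply]
      change (ψ _).1 ⊆ _ ↔ _
      rw [hψ, singleton_subset_iff]
      exact ⟨fun h => boolSign_injective h.2, fun h => ⟨cubePoint_mem s, congrArg boolSign h⟩⟩
    have hs0 : v (fun _ => ε) ∈ G.1 := (hmem _).2 rfl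
    obtain ⟨l, hl⟩ := G.2 ⟨_, hs0⟩
    rw [hl] at hs0
    refine ⟨AffineMap.const ℝ E3 (l (v fun _ => ε)) - l.toLinearMap.toAffineMap,
      fun x hx => sub_nonneg.2 (hs0.2 x hx), fun s => ?_⟩
    rw [← hmem, hl]
    change l (v fun _ => ε) - l (v s) = 0 ↔ _
    refine ⟨fun h => ⟨hK s, fun y hy => (hs0.2 y hy).trans (sub_eq_zero.1 h).le⟩, fun h => ?_⟩
    exact sub_eq_zero.2 (le_antisymm (h.2 _ hs0.1) (hs0.2 _ (hK s)))
  choose f hf0 hfv using hfacet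
  exact ⟨⟨convex_convexHull ℝ V, v, f, fun s => norm_of_mem_sphere hV (hv s), hK, hf0, hfv⟩⟩

theorem hypVolume_le_of_hasCubeType {Q : Set E3} (h : IsIdealPolyhedron Q) (hQ : HasCubeType Q) :
    hypVolume Q ≤ 5 * regularVolume := by
  obtain ⟨V, hf, hV, ht, rfl⟩ := h
  rw [HasCubeType, closure_idealHull hf hV ht] at hQ
  obtain ⟨ψ⟩ := hQ
  obtain ⟨c⟩ := exists_cubeConfig hf hV ψ
  exact c.hypVolume_le

/-! ### Projective maps and Lorentz transformations -/

open Matrix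

/-- Homogeneous coordinates of a point of `E3`. -/
def hom (x : E3) : Fin 4 → ℝ := ![1, x 0, x 1, x 2]

/-- The Minkowski form, of signature `(1, 3)`. -/
def minkowski : Matrix (Fin 4) (Fin 4) ℝ := Matrix.diagonal ![1, -1, -1, -1]

theorem dotProduct_minkowski (a b : Fin 4 → ℝ) :
    a ⬝ᵥ minkowski *ᵥ b = a 0 * b 0 - a 1 * b 1 - a 2 * b 2 - a 3 * b 3 := by
  simp [minkowski, dotProduct, Fin.sum_univ_four, Matrix.mulVec_diagonal]
  ring

theorem minkowski_det : minkowski.det ≠ 0 := by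
  simp [minkowski, Matrix.det_diagonal, Fin.prod_univ_four]

theorem E3_inner (x y : E3) : ⟪x, y⟫ = x 0 * y 0 + x 1 * y 1 + x 2 * y 2 := by
  simp [PiLp.inner_apply, Fin.sum_univ_three]
  ring

theorem hom_minkowski_hom (x y : E3) : hom x ⬝ᵥ minkowski *ᵥ hom y = 1 - ⟪x, y⟫ := by
  rw [dotProduct_minkowski, E3_inner]
  simp [hom]
  ring

theorem hom_injective : Function.Injective hom := fun x y h => by
  ext i
  fin_cases i
  exacts [congrFun h 1, congrFun h 2, congrFun h 3]

theorem hom_combo {a b : ℝ} (hab : a + b = 1) (x y : E3) :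
    hom (a • x + b • y) = a • hom x + b • hom y := by
  ext i
  fin_cases i <;> simp [hom, hab]

/-- The denominator of the projective map with matrix `A`. -/
def projDenom (A : Matrix (Fin 4) (Fin 4) ℝ) (x : E3) : ℝ := (A *ᵥ hom x) 0

/-- The projective map with matrix `A`, in the affine chart `E3`. -/
noncomputable def projMap (A : Matrix (Fin 4) (Fin 4) ℝ) (x : E3) : E3 :=
  WithLp.toLp 2 fun i => (A *ᵥ hom x) i.succ / projDenom A x

theorem hom_projMap {A : Matrix (Fin 4) (Fin 4) ℝ} {x : E3} (h : projDenom A x ≠ 0) :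
    hom (projMap A x) = (projDenom A x)⁻¹ • A *ᵥ hom x := by
  have h' : (A *ᵥ hom x) 0 ≠ 0 := h
  ext i
  fin_cases i
  · simp [hom, projDenom] at h' ⊢
    rw [inv_mul_cancel₀ h']
  all_goals
    simp [hom, projMap, div_eq_inv_mul]

theorem projMap_eq_of_smul {A : Matrix (Fin 4) (Fin 4) ℝ} {x y : E3} {c : ℝ} (hc : c ≠ 0)
    (h : c • hom y = A *ᵥ hom x) : projMap A x = y := by
  have h0 : projDenom A x = c := by
    rw [projDenom, ← h]; simp [hom]
  refine hom_injective ?_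
  rw [hom_projMap (by rwa [h0]), ← h, h0, smul_smul, inv_mul_cancel₀ hc, one_smul]

theorem projMap_injOn {A : Matrix (Fin 4) (Fin 4) ℝ} (hA : A.det ≠ 0) {D : Set E3}
    (hD : ∀ x ∈ D, 0 < projDenom A x) : InjOn (projMap A) D := by
  intro x hx y hy h
  have h1 := congrArg hom h
  rw [hom_projMap (hD x hx).ne', hom_projMap (hD y hy).ne', ← mulVec_smul, ← mulVec_smul] at h1
  have h2 := Matrix.mulVec_injective_of_isUnit
    ((Matrix.isUnit_iff_isUnit_det _).2 (isUnit_iff_ne_zero.2 hA)) h1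
  have h3 : (projDenom A x)⁻¹ = (projDenom A y)⁻¹ := by simpa [hom] using congrFun h2 0
  rw [h3] at h2
  exact hom_injective (smul_right_injective _ (inv_ne_zero (hD y hy).ne') h2)

theorem projDenom_combo (A : Matrix (Fin 4) (Fin 4) ℝ) {a b : ℝ} (hab : a + b = 1) (x y : E3) :
    projDenom A (a • x + b • y) = a * projDenom A x + b * projDenom A y := by
  simp [projDenom, hom_combo hab, mulVec_add, mulVec_smul]

theorem projMap_combo {A : Matrix (Fin 4) (Fin 4) ℝ} {a b : ℝ} (ha : 0 ≤ a) (hb : 0 ≤ b)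
    (hab : a + b = 1) {x y : E3} (hx : 0 < projDenom A x) (hy : 0 < projDenom A y) :
    projMap A (a • x + b • y) =
      (a * projDenom A x / (a * projDenom A x + b * projDenom A y)) • projMap A x +
        (b * projDenom A y / (a * projDenom A x + b * projDenom A y)) • projMap A y := by
  have hpos : 0 < a * projDenom A x + b * projDenom A y := by
    rcases ha.eq_or_lt with rfl | ha
    · rw [zero_add] at hab; subst hab; simpa using hy
    · positivity
  refine projMap_eq_of_smul hpos.ne' ?_
  rw [hom_combo (by field_simp), hom_projMap hx.ne', hom_projMap hy.ne', hom_combo hab, mulVec_add,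
    mulVec_smul, mulVec_smul, smul_add, smul_smul, smul_smul, smul_smul, smul_smul]
  congr 2 <;> field_simp

/-- Projective maps carry convex hulls to convex hulls. -/
theorem projMap_image_convexHull {A : Matrix (Fin 4) (Fin 4) ℝ} {D : Set E3} (hDc : Convex ℝ D)
    (hD : ∀ x ∈ D, 0 < projDenom A x) {V : Set E3} (hV : V ⊆ D) :
    projMap A '' convexHull ℝ V = convexHull ℝ (projMap A '' V) := by
  have hVD : convexHull ℝ V ⊆ D := convexHull_min hV hDc
  refine Subset.antisymm ?_ (convexHull_min (image_mono (subset_convexHull ℝ V)) ?_)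
  · have hc : Convex ℝ {x | x ∈ D ∧ projMap A x ∈ convexHull ℝ (projMap A '' V)} := by
      intro x hx y hy a b ha hb hab
      refine ⟨hDc hx.1 hy.1 ha hb hab, ?_⟩
      have h1 := hD x hx.1
      have h2 := hD y hy.1
      have hpos : 0 < a * projDenom A x + b * projDenom A y := by
        rw [← projDenom_combo A hab]; exact hD _ (hDc hx.1 hy.1 ha hb hab)
      rw [projMap_combo ha hb hab h1 h2]
      exact convex_convexHull ℝ _ hx.2 hy.2 (by positivity) (by positivity) (by field_simp)
    rintro _ ⟨x, hx, rfl⟩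
    have hsub : V ⊆ {x | x ∈ D ∧ projMap A x ∈ convexHull ℝ (projMap A '' V)} :=
      fun v hv => ⟨hV hv, subset_convexHull ℝ _ (mem_image_of_mem _ hv)⟩
    exact (convexHull_min hsub hc hx).2
  · rintro _ ⟨x, hx, rfl⟩ _ ⟨y, hy, rfl⟩ a b ha hb hab
    have h1 := hD x (hVD hx)
    have h2 := hD y (hVD hy)
    obtain ⟨t, ht⟩ : ∃ t, t = a / projDenom A x + b / projDenom A y := ⟨_, rfl⟩
    have ht0 : 0 < t := by
      rw [ht]
      rcases ha.eq_or_lt with rfl | ha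
      · rw [zero_add] at hab; subst hab; simpa using h2
      · have := div_pos ha h1
        positivity
    have hsum : a / projDenom A x / t + b / projDenom A y / t = 1 := by
      rw [← add_div, ← ht, div_self ht0.ne']
    have hab' : a + b ≠ 0 := by rw [hab]; norm_num
    refine ⟨(a / projDenom A x / t) • x + (b / projDenom A y / t) • y,
      convex_convexHull ℝ V hx hy (by positivity) (by positivity) hsum, ?_⟩
    rw [projMap_combo (by positivity) (by positivity) hsum h1 h2]
    have e1 : a / projDenom A x / t * projDenom A x = a / t := by field_simp
    have e2 : b / projDenom A y / t * projDenom A y = b / t := by field_simp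
    rw [e1, e2, ← add_div, hab]
    congr 2 <;> field_simp

/-- The matrix `A` is a Lorentz transformation preserving the future cone. -/
structure IsLorentz (A : Matrix (Fin 4) (Fin 4) ℝ) : Prop where
  transpose_mul : Aᵀ * minkowski * A = minkowski
  denom_pos : ∀ x : E3, ‖x‖ ≤ 1 → 0 < projDenom A x

theorem IsLorentz.det_ne_zero {A : Matrix (Fin 4) (Fin 4) ℝ} (hA : IsLorentz A) : A.det ≠ 0 :=
  fun h => by
    have := congrArg Matrix.det hA.transpose_mul
    rw [det_mul, h, mul_zero] at this
    exact minkowski_det this.symm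

theorem minkowski_mulVec {A : Matrix (Fin 4) (Fin 4) ℝ} (h : Aᵀ * minkowski * A = minkowski)
    (a b : Fin 4 → ℝ) : (A *ᵥ a) ⬝ᵥ minkowski *ᵥ (A *ᵥ b) = a ⬝ᵥ minkowski *ᵥ b := by
  conv_rhs => rw [← h]
  rw [← vecMul_transpose A a, ← dotProduct_mulVec]
  simp only [mulVec_mulVec, Matrix.mul_assoc]

theorem IsLorentz.one_sub_inner {A : Matrix (Fin 4) (Fin 4) ℝ} (hA : IsLorentz A) {x y : E3}
    (hx : ‖x‖ ≤ 1) (hy : ‖y‖ ≤ 1) :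
    (1 - ⟪projMap A x, projMap A y⟫) * (projDenom A x * projDenom A y) = 1 - ⟪x, y⟫ := by
  have h1 := hA.denom_pos x hx
  have h2 := hA.denom_pos y hy
  rw [← hom_minkowski_hom, hom_projMap h1.ne', hom_projMap h2.ne', mulVec_smul, smul_dotProduct,
    dotProduct_smul, minkowski_mulVec hA.transpose_mul, hom_minkowski_hom, smul_eq_mul, smul_eq_mul]
  field_simp

theorem IsLorentz.one_sub_norm_sq {A : Matrix (Fin 4) (Fin 4) ℝ} (hA : IsLorentz A) {x : E3}
    (hx : ‖x‖ ≤ 1) : (1 - ‖projMap A x‖ ^ 2) * projDenom A x ^ 2 = 1 - ‖x‖ ^ 2 := by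
  have := hA.one_sub_inner hx hx
  rwa [real_inner_self_eq_norm_sq, real_inner_self_eq_norm_sq, ← sq] at this

theorem IsLorentz.norm_projMap_eq_one {A : Matrix (Fin 4) (Fin 4) ℝ} (hA : IsLorentz A) {x : E3}
    (hx : ‖x‖ = 1) : ‖projMap A x‖ = 1 := by
  have h := hA.one_sub_norm_sq hx.le
  have h1 := hA.denom_pos x hx.le
  rw [hx, one_pow, sub_self] at h
  have h2 : 1 - ‖projMap A x‖ ^ 2 = 0 := (mul_eq_zero.1 h).resolve_right (pow_pos h1 2).ne'
  nlinarith [norm_nonneg (projMap A x)]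

theorem IsLorentz.norm_projMap_lt_one {A : Matrix (Fin 4) (Fin 4) ℝ} (hA : IsLorentz A) {x : E3}
    (hx : ‖x‖ < 1) : ‖projMap A x‖ < 1 := by
  have h := hA.one_sub_norm_sq hx.le
  have h1 := hA.denom_pos x hx.le
  have h2 : 0 < (1 - ‖projMap A x‖ ^ 2) * projDenom A x ^ 2 := by
    rw [h]; nlinarith [norm_nonneg x]
  have h3 := pos_of_mul_pos_left h2 (by positivity)
  nlinarith [norm_nonneg (projMap A x)]

theorem IsLorentz.dist_sq {A : Matrix (Fin 4) (Fin 4) ℝ} (hA : IsLorentz A) {x y : E3}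
    (hx : ‖x‖ = 1) (hy : ‖y‖ = 1) :
    dist (projMap A x) (projMap A y) ^ 2 * (projDenom A x * projDenom A y) = dist x y ^ 2 := by
  have h := hA.one_sub_inner hx.le hy.le
  rw [dist_eq_norm, dist_eq_norm, norm_sub_sq_real, norm_sub_sq_real, hx, hy,
    hA.norm_projMap_eq_one hx, hA.norm_projMap_eq_one hy]
  linear_combination 2 * h

theorem IsLorentz.image_idealHull {A : Matrix (Fin 4) (Fin 4) ℝ} (hA : IsLorentz A) {V : Set E3}
    (hV : V ⊆ Metric.sphere 0 1) : projMap A '' idealHull V = idealHull (projMap A '' V) := by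
  have hn : ∀ x ∈ V, ‖x‖ ≤ 1 := fun x hx => (norm_of_mem_sphere hV hx).le
  have hsub := convexHull_subset_closedBall hn
  rw [idealHull, idealHull, ← projMap_image_convexHull (convex_closedBall (0 : E3) 1)
    (fun x hx => hA.denom_pos x (by simpa using hx)) (fun x hx => by simpa using hn x hx)]
  refine Subset.antisymm ?_ ?_
  · rintro _ ⟨x, ⟨hx, hx'⟩, rfl⟩
    have h1 : ‖x‖ < 1 := by simpa [H3] using hx'
    exact ⟨mem_image_of_mem _ hx, by simpa [H3] using hA.norm_projMap_lt_one h1⟩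
  · rintro _ ⟨⟨x, hx, rfl⟩, hx'⟩
    have h1 : ‖x‖ ≤ 1 := by simpa using hsub hx
    have h2 : ‖projMap A x‖ < 1 := by simpa [H3] using hx'
    refine mem_image_of_mem _ ⟨hx, ?_⟩
    rcases h1.eq_or_lt with h3 | h3
    · rw [hA.norm_projMap_eq_one h3] at h2
      exact absurd h2 (lt_irrefl _)
    · simpa [H3] using h3

/-! ### Isometries of the Klein model are Lorentz transformations -/

/-- The point of the hyperboloid over a point of the Klein model. -/
noncomputable def hyperboloidLift (x : E3) : Fin 4 → ℝ := (√(1 - ‖x‖ ^ 2))⁻¹ • hom x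

theorem one_sub_norm_sq_pos {x : E3} (hx : x ∈ H3) : 0 < 1 - ‖x‖ ^ 2 := by
  have h1 : ‖x‖ < 1 := by simpa [H3] using hx
  nlinarith [norm_nonneg x]

/-- The Minkowski product of two lifts is the hyperbolic cosine of the distance. -/
theorem lift_minkowski_lift (x y : E3) :
    hyperboloidLift x ⬝ᵥ minkowski *ᵥ hyperboloidLift y =
      (1 - ⟪x, y⟫) / (√(1 - ‖x‖ ^ 2) * √(1 - ‖y‖ ^ 2)) := by
  rw [hyperboloidLift, hyperboloidLift, mulVec_smul, smul_dotProduct, dotProduct_smul,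
    hom_minkowski_hom, smul_eq_mul, smul_eq_mul, div_eq_inv_mul, mul_inv, mul_assoc]

theorem lift_minkowski_lift_pos {x y : E3} (hx : x ∈ H3) (hy : y ∈ H3) :
    0 < hyperboloidLift x ⬝ᵥ minkowski *ᵥ hyperboloidLift y := by
  have h1 := one_sub_norm_sq_pos hx
  have h2 := one_sub_norm_sq_pos hy
  have hx1 : ‖x‖ < 1 := by simpa [H3] using hx
  have hy1 : ‖y‖ < 1 := by simpa [H3] using hy
  have h3 : ⟪x, y⟫ < 1 := by
    have := real_inner_le_norm x y
    nlinarith [norm_nonneg x, norm_nonneg y]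
  rw [lift_minkowski_lift]
  have : 0 < 1 - ⟪x, y⟫ := by linarith
  positivity

theorem lift_minkowski_lift_eq {φ : E3 → E3} (h : IsHypIsometry φ) {x y : E3} (hx : x ∈ H3)
    (hy : y ∈ H3) : hyperboloidLift (φ x) ⬝ᵥ minkowski *ᵥ hyperboloidLift (φ y) =
      hyperboloidLift x ⬝ᵥ minkowski *ᵥ hyperboloidLift y := by
  refine Real.strictMonoOn_arcosh.injOn
    (lift_minkowski_lift_pos (h.1.mapsTo hx) (h.1.mapsTo hy)) (lift_minkowski_lift_pos hx hy) ?_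
  rw [lift_minkowski_lift, lift_minkowski_lift]
  exact h.2 x hx y hy

/-- Four points of `H3` whose lifts to the hyperboloid are linearly independent. -/
noncomputable def framePoint : Fin 4 → E3 :=
  ![0, !₂[1 / 2, 0, 0], !₂[0, 1 / 2, 0], !₂[0, 0, 1 / 2]]

theorem framePoint_mem (i : Fin 4) : framePoint i ∈ H3 := by
  have : ‖framePoint i‖ ^ 2 < 1 := by
    rw [E3_norm_sq]
    fin_cases i <;> simp [framePoint] <;> norm_num
  have h : ‖framePoint i‖ < 1 := by
    nlinarith [norm_nonneg (framePoint i)]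
  simpa [H3] using h

theorem vertexMatrix_eq_hom (v : Fin 4 → E3) : vertexMatrix v = Matrix.of fun i => hom (v i) := rfl

theorem det_lift_framePoint :
    (Matrix.of fun i => hyperboloidLift (framePoint i)).det ≠ 0 := by
  have h1 : (Matrix.of fun i => hyperboloidLift (framePoint i)) =
      Matrix.diagonal (fun i => (√(1 - ‖framePoint i‖ ^ 2))⁻¹) * vertexMatrix framePoint := by
    ext i j
    simp [Matrix.diagonal_mul, vertexMatrix_eq_hom, hyperboloidLift]
  have h2 : (vertexMatrix framePoint).det ≠ 0 := by
    rw [det_succ_row_zero]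
    simp [vertexMatrix, framePoint, Fin.sum_univ_succ, Fin.succAbove, Matrix.submatrix,
      Matrix.det_fin_three]
  rw [h1, det_mul, det_diagonal]
  refine mul_ne_zero (Finset.prod_ne_zero_iff.2 fun i _ => ?_) h2
  have := one_sub_norm_sq_pos (framePoint_mem i)
  positivity

theorem frame_mulVec (P : Fin 4 → E3) (a : Fin 4 → ℝ) (i : Fin 4) :
    (((Matrix.of fun i => hyperboloidLift (P i)) * minkowski) *ᵥ a) i =
      hyperboloidLift (P i) ⬝ᵥ minkowski *ᵥ a := by
  rw [← mulVec_mulVec]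
  rfl

/-- A matrix that preserves the Minkowski form and acts on the open ball with positive denominators
has positive denominators on the closed ball: there they are nonnegative by continuity, and the
image of a null vector is a nonzero null vector. -/
theorem isLorentz_of_pos_on_H3 {A : Matrix (Fin 4) (Fin 4) ℝ}
    (h : Aᵀ * minkowski * A = minkowski) (hpos : ∀ x ∈ H3, 0 < projDenom A x) : IsLorentz A := by
  refine ⟨h, fun x hx => ?_⟩
  rcases hx.lt_or_eq with hx | hx
  · exact hpos x (by simpa [H3] using hx)
  have h0 := hpos 0 (by simp [H3])
  have hmix : ∀ t : ℝ, 0 ≤ t → t < 1 → 0 < (1 - t) * projDenom A 0 + t * projDenom A x := by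
    intro t ht ht1
    rw [← projDenom_combo A (by ring)]
    refine hpos _ ?_
    have : ‖t • x‖ < 1 := by
      rwa [norm_smul, hx, mul_one, Real.norm_eq_abs, abs_of_nonneg ht]
    simpa [H3] using this
  rcases lt_trichotomy (projDenom A x) 0 with hneg | hzero | hp
  · have hd : 0 < projDenom A 0 - projDenom A x := by linarith
    have := hmix (projDenom A 0 / (projDenom A 0 - projDenom A x)) (by positivity)
      ((div_lt_one hd).2 (by linarith))
    have e : (1 - projDenom A 0 / (projDenom A 0 - projDenom A x)) * projDenom A 0 +
        projDenom A 0 / (projDenom A 0 - projDenom A x) * projDenom A x = 0 := by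
      field_simp; ring
    linarith
  · exfalso
    have hnull := minkowski_mulVec h (hom x) (hom x)
    rw [hom_minkowski_hom, real_inner_self_eq_norm_sq, hx, dotProduct_minkowski] at hnull
    have hz : (A *ᵥ hom x) 0 = 0 := hzero
    rw [hz] at hnull
    have s1 := sq_nonneg ((A *ᵥ hom x) 1)
    have s2 := sq_nonneg ((A *ᵥ hom x) 2)
    have s3 := sq_nonneg ((A *ᵥ hom x) 3)
    have e1 : (A *ᵥ hom x) 1 = 0 := by nlinarith
    have e2 : (A *ᵥ hom x) 2 = 0 := by nlinarith
    have e3 : (A *ᵥ hom x) 3 = 0 := by nlinarith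
    have hA : A *ᵥ hom x = 0 := by
      ext i
      fin_cases i
      exacts [hz, e1, e2, e3]
    have hdet : A.det ≠ 0 := fun h' => by
      have := congrArg Matrix.det h
      rw [det_mul, h', mul_zero] at this
      exact minkowski_det this.symm
    have := congrFun (Matrix.eq_zero_of_mulVec_eq_zero hdet hA) 0
    simp [hom] at this
  · exact hp

/-- Every isometry of the Klein model is the restriction of a projective map coming from a Lorentz
transformation. -/
theorem IsHypIsometry.exists_isLorentz {φ : E3 → E3} (h : IsHypIsometry φ) :
    ∃ A, IsLorentz A ∧ ∀ x ∈ H3, φ x = projMap A x := by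
  obtain ⟨X, hX⟩ : ∃ X : Matrix (Fin 4) (Fin 4) ℝ,
    X = Matrix.of fun i => hyperboloidLift (framePoint i) := ⟨_, rfl⟩
  obtain ⟨Y, hY⟩ : ∃ Y : Matrix (Fin 4) (Fin 4) ℝ,
    Y = Matrix.of fun i => hyperboloidLift (φ (framePoint i)) := ⟨_, rfl⟩
  have hXd : X.det ≠ 0 := hX ▸ det_lift_framePoint
  -- Minkowski products with the frame are preserved; as they determine a vector, the lift of `φ x`
  -- depends linearly on the lift of `x`
  have hmul : ∀ x ∈ H3, (Y * minkowski) *ᵥ hyperboloidLift (φ x) =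
      (X * minkowski) *ᵥ hyperboloidLift x := by
    intro x hx
    ext i
    rw [hX, hY, frame_mulVec framePoint, frame_mulVec fun i => φ (framePoint i)]
    exact lift_minkowski_lift_eq h (framePoint_mem i) hx
  have hgram : Y * minkowski * Yᵀ = X * minkowski * Xᵀ := by
    ext i j
    have h1 := congrFun (hmul _ (framePoint_mem j)) i
    have e : ∀ (M N : Matrix (Fin 4) (Fin 4) ℝ) (i j), (M * Nᵀ) i j = (M *ᵥ N j) i :=
      fun M N i j => rfl
    rw [e, e, hX, hY] at *
    exact h1
  have hYd : Y.det ≠ 0 := by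
    intro h0
    have := congrArg Matrix.det hgram
    rw [det_mul, det_mul, h0, zero_mul, zero_mul, det_mul, det_mul, det_transpose] at this
    exact mul_ne_zero (mul_ne_zero hXd minkowski_det) hXd this.symm
  have hYJ : IsUnit (Y * minkowski).det := by
    rw [det_mul]; exact isUnit_iff_ne_zero.2 (mul_ne_zero hYd minkowski_det)
  obtain ⟨A, hA⟩ : ∃ A, A = (Y * minkowski)⁻¹ * (X * minkowski) := ⟨_, rfl⟩
  have hYA : Y * minkowski * A = X * minkowski := by
    rw [hA, Matrix.mul_nonsing_inv_cancel_left _ _ hYJ]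
  have hlift : ∀ x ∈ H3, hyperboloidLift (φ x) = A *ᵥ hyperboloidLift x := by
    intro x hx
    rw [hA, ← mulVec_mulVec, ← hmul x hx, mulVec_mulVec, Matrix.nonsing_inv_mul _ hYJ, one_mulVec]
  have hAX : A * Xᵀ = Yᵀ := by
    ext i j
    have := congrFun (hlift _ (framePoint_mem j)) i
    rw [hX, hY]
    exact this.symm
  have hlor : Aᵀ * minkowski * A = minkowski := by
    have hXu : IsUnit X.det := isUnit_iff_ne_zero.2 hXd
    have hXtu : IsUnit Xᵀ.det := by rwa [det_transpose]
    have e : X * (Aᵀ * minkowski * A) * Xᵀ = X * minkowski * Xᵀ := by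
      calc X * (Aᵀ * minkowski * A) * Xᵀ = (A * Xᵀ)ᵀ * minkowski * (A * Xᵀ) := by
            rw [transpose_mul, transpose_transpose]; simp only [Matrix.mul_assoc]
        _ = _ := by rw [hAX, transpose_transpose, hgram]
    have e2 := congrArg (· * (Xᵀ)⁻¹) e
    simp only [Matrix.mul_nonsing_inv_cancel_right _ _ hXtu] at e2
    have e3 := congrArg (X⁻¹ * ·) e2
    simpa only [Matrix.nonsing_inv_mul_cancel_left _ _ hXu] using e3
  have hscale : ∀ x ∈ H3, √(1 - ‖x‖ ^ 2) * (√(1 - ‖φ x‖ ^ 2))⁻¹ > 0 ∧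
      (√(1 - ‖x‖ ^ 2) * (√(1 - ‖φ x‖ ^ 2))⁻¹) • hom (φ x) = A *ᵥ hom x := by
    intro x hx
    have h1 := Real.sqrt_pos.2 (one_sub_norm_sq_pos hx)
    have h2 := Real.sqrt_pos.2 (one_sub_norm_sq_pos (h.1.mapsTo hx))
    refine ⟨by positivity, ?_⟩
    have := hlift x hx
    rw [hyperboloidLift, hyperboloidLift, mulVec_smul] at this
    rw [mul_smul, this, smul_smul, mul_inv_cancel₀ h1.ne', one_smul]
  refine ⟨A, isLorentz_of_pos_on_H3 hlor fun x hx => ?_, fun x hx => ?_⟩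
  · obtain ⟨h1, h2⟩ := hscale x hx
    rw [projDenom, ← h2]
    simpa [hom] using h1
  · obtain ⟨h1, h2⟩ := hscale x hx
    exact (projMap_eq_of_smul h1.ne' h2).symm

/-! ### Projective invariance of the face lattice, and the inscribed cube -/

/-- The affine function given by a covector in homogeneous coordinates. -/
noncomputable def rowAffine (a : Fin 4 → ℝ) : E3 →ᵃ[ℝ] ℝ :=
  AffineMap.const ℝ E3 (a 0) +
    (∑ k : Fin 3, a k.succ • (EuclideanSpace.proj k : E3 →L[ℝ] ℝ)).toLinearMap.toAffineMap

theorem rowAffine_apply (a : Fin 4 → ℝ) (x : E3) : rowAffine a x = a ⬝ᵥ hom x := by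
  simp [rowAffine, dotProduct, Fin.sum_univ_succ, hom]

/-- Exposed faces are the zero sets of nonnegative affine functions, here written as covectors. -/
theorem isExposed_iff_exists_row {K F : Set E3} : IsExposed ℝ K F ↔
    (F.Nonempty → ∃ a : Fin 4 → ℝ, (∀ x ∈ K, 0 ≤ a ⬝ᵥ hom x) ∧ F = {x ∈ K | a ⬝ᵥ hom x = 0}) := by
  refine forall_congr' fun hne => ⟨?_, ?_⟩
  · rintro ⟨l, hl⟩
    obtain ⟨x₀, hx₀⟩ := hne
    rw [hl] at hx₀
    obtain ⟨w, hw⟩ : ∃ w, w = (InnerProductSpace.toDual ℝ E3).symm l := ⟨_, rfl⟩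
    have hlw : ∀ x, l x = w 0 * x 0 + w 1 * x 1 + w 2 * x 2 := fun x => by
      rw [← E3_inner, hw, InnerProductSpace.toDual_symm_apply]
    have ha : ∀ x, ![l x₀, -w 0, -w 1, -w 2] ⬝ᵥ hom x = l x₀ - l x := fun x => by
      rw [hlw x]
      simp [dotProduct, Fin.sum_univ_four, hom]
      ring
    refine ⟨![l x₀, -w 0, -w 1, -w 2], fun x hx => ?_, ?_⟩
    · rw [ha]; exact sub_nonneg.2 (hx₀.2 x hx)
    · rw [hl]
      ext x
      simp only [ha, sub_eq_zero]
      exact and_congr_right fun hx => ⟨fun h => le_antisymm (h _ hx₀.1) (hx₀.2 _ hx),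
        fun h y hy => (hx₀.2 y hy).trans h.le⟩
  · rintro ⟨a, ha, hF⟩
    obtain ⟨x₀, hx₀⟩ := hne
    rw [hF] at hx₀
    refine ⟨-∑ k : Fin 3, a k.succ • (EuclideanSpace.proj k : E3 →L[ℝ] ℝ), ?_⟩
    have hl : ∀ x, (-∑ k : Fin 3, a k.succ • (EuclideanSpace.proj k : E3 →L[ℝ] ℝ)) x =
        a 0 - a ⬝ᵥ hom x := fun x => by
      simp [dotProduct, Fin.sum_univ_succ, hom]
    rw [hF]
    ext x
    simp only [hl]
    refine and_congr_right fun hx => ⟨fun h y hy => ?_, fun h => ?_⟩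
    · linarith [ha y hy]
    · have h1 := h x₀ hx₀.1
      have h2 := hx₀.2
      have h3 := ha x hx
      linarith

/-- Projective maps induce isomorphisms of face lattices. -/
theorem nonempty_faceLattice_orderIso_projMap {A : Matrix (Fin 4) (Fin 4) ℝ} (hA : A.det ≠ 0)
    {K : Set E3} (hK : ∀ x ∈ K, 0 < projDenom A x) :
    Nonempty (FaceLattice (projMap A '' K) ≃o FaceLattice K) := by
  have hinj := projMap_injOn hA hK
  have hAu : IsUnit A.det := isUnit_iff_ne_zero.2 hA
  have hrow : ∀ (b : Fin 4 → ℝ) (x) (_ : x ∈ K),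
      b ⬝ᵥ hom (projMap A x) = (projDenom A x)⁻¹ * (b ᵥ* A ⬝ᵥ hom x) := by
    intro b x hx
    rw [hom_projMap (hK x hx).ne', dotProduct_smul, dotProduct_mulVec, smul_eq_mul]
  have hto : ∀ F, IsExposed ℝ K F → IsExposed ℝ (projMap A '' K) (projMap A '' F) := by
    intro F hF
    rw [isExposed_iff_exists_row] at hF ⊢
    intro hne
    obtain ⟨a, ha, hFa⟩ := hF hne.of_image
    have hb : ∀ x ∈ K, a ᵥ* A⁻¹ ⬝ᵥ hom (projMap A x) = (projDenom A x)⁻¹ * (a ⬝ᵥ hom x) := by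
      intro x hx
      rw [hrow _ x hx, vecMul_vecMul, Matrix.nonsing_inv_mul _ hAu, vecMul_one]
    refine ⟨a ᵥ* A⁻¹, ?_, ?_⟩
    · rintro _ ⟨x, hx, rfl⟩
      rw [hb x hx]
      exact mul_nonneg (inv_pos.2 (hK x hx)).le (ha x hx)
    · rw [hFa]
      ext y
      constructor
      · rintro ⟨x, ⟨hx, hx0⟩, rfl⟩
        exact ⟨mem_image_of_mem _ hx, by rw [hb x hx, hx0, mul_zero]⟩
      · rintro ⟨⟨x, hx, rfl⟩, hx0⟩
        rw [hb x hx] at hx0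
        exact ⟨x, ⟨hx, (mul_eq_zero.1 hx0).resolve_left (inv_pos.2 (hK x hx)).ne'⟩, rfl⟩
  have hinv : ∀ G, IsExposed ℝ (projMap A '' K) G → IsExposed ℝ K (K ∩ projMap A ⁻¹' G) := by
    intro G hG
    rw [isExposed_iff_exists_row] at hG ⊢
    rintro ⟨x₀, hx₀⟩
    obtain ⟨b, hb, hGb⟩ := hG ⟨_, hx₀.2⟩
    have ha : ∀ x ∈ K, b ᵥ* A ⬝ᵥ hom x = projDenom A x * (b ⬝ᵥ hom (projMap A x)) := by
      intro x hx
      rw [hrow b x hx, mul_inv_cancel_left₀ (hK x hx).ne']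
    refine ⟨b ᵥ* A, fun x hx => ?_, ?_⟩
    · rw [ha x hx]
      exact mul_nonneg (hK x hx).le (hb _ (mem_image_of_mem _ hx))
    · rw [hGb]
      ext x
      refine and_congr_right fun hx => ?_
      rw [ha x hx, mul_eq_zero, or_iff_right (hK x hx).ne']
      exact ⟨fun h => h.2, fun h => ⟨mem_image_of_mem _ hx, h⟩⟩
  refine ⟨OrderIso.symm
    { toFun := fun F => ⟨projMap A '' F.1, hto _ F.2⟩
      invFun := fun G => ⟨K ∩ projMap A ⁻¹' G.1, hinv _ G.2⟩
      left_inv := fun F => Subtype.ext ?_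
      right_inv := fun G => Subtype.ext ?_
      map_rel_iff' := fun {F G} => ?_ }⟩
  · change K ∩ projMap A ⁻¹' (projMap A '' F.1) = F.1
    rw [inter_comm]
    exact hinj.preimage_image_inter F.2.subset
  · change projMap A '' (K ∩ projMap A ⁻¹' G.1) = G.1
    rw [image_inter_preimage, inter_eq_right]
    exact G.2.subset
  · exact hinj.image_subset_image_iff F.2.subset G.2.subset

/-- The ideal vertices of the regular ideal cube centred at the origin. -/
noncomputable def stdVertex (s : CubeVertex) : E3 :=
  WithLp.toLp 2 fun k => boolSign (s k) * (√3)⁻¹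

@[simp] theorem stdVertex_apply (s : CubeVertex) (k : Fin 3) :
    stdVertex s k = boolSign (s k) * (√3)⁻¹ := rfl

/-- The homothety from the cube `[-1, 1]³` to the cube inscribed in the unit sphere, as a
projective map. -/
noncomputable def scaleMatrix : Matrix (Fin 4) (Fin 4) ℝ := Matrix.diagonal ![√3, 1, 1, 1]

theorem projDenom_scaleMatrix (x : E3) : projDenom scaleMatrix x = √3 := by
  simp [projDenom, scaleMatrix, mulVec_diagonal, hom]

theorem projMap_scaleMatrix (s : CubeVertex) : projMap scaleMatrix (cubePoint s) = stdVertex s := by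
  ext k
  rw [projMap, projDenom_scaleMatrix]
  fin_cases k <;> simp [scaleMatrix, mulVec_diagonal, hom, div_eq_mul_inv]

theorem euclideanCube_eq_convexHull : euclideanCube = convexHull ℝ (range cubePoint) := by
  have h1 : range cubePoint =
      (WithLp.linearEquiv 2 ℝ (Fin 3 → ℝ)).symm '' univ.pi fun _ => {-1, 1} := by
    ext x
    constructor
    · rintro ⟨s, rfl⟩
      refine ⟨fun k => boolSign (s k), fun k _ => ?_, rfl⟩
      cases h : s k <;> simp [boolSign, h]
    · rintro ⟨y, hy, rfl⟩
      refine ⟨fun k => decide (y k = 1), ?_⟩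
      ext k
      rcases hy k trivial with h | h
      · have h : y k = -1 := h
        simp [boolSign, h]
        norm_num
      · have h : y k = 1 := h
        simp [boolSign, h]
  have h2 : convexHull ℝ (range cubePoint) =
      (WithLp.linearEquiv 2 ℝ (Fin 3 → ℝ)).symm '' univ.pi fun _ => Icc (-1) 1 := by
    rw [h1, ← LinearEquiv.coe_coe, ← LinearMap.image_convexHull, convexHull_pi]
    simp only [convexHull_pair, segment_eq_Icc (show (-1 : ℝ) ≤ 1 by norm_num)]
  rw [h2]
  ext x
  constructor
  · intro hx
    exact ⟨fun k => x k, fun k _ => abs_le.1 (hx k), rfl⟩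
  · rintro ⟨y, hy, rfl⟩ k
    exact abs_le.2 (hy k trivial)

theorem cubeVertices_eq_range : cubeVertices = range stdVertex := by
  have h3 : 0 < (√3)⁻¹ := by positivity
  ext x
  constructor
  · intro hx
    refine ⟨fun k => decide (x k = (√3)⁻¹), ?_⟩
    ext k
    rcases eq_or_eq_neg_of_abs_eq (hx k) with h | h
    · simp [boolSign, h]
    · have : ¬ x k = (√3)⁻¹ := by rw [h]; linarith
      simp only [stdVertex_apply, boolSign, this]
      simp [h]
  · rintro ⟨s, rfl⟩ k
    rw [stdVertex_apply, abs_mul, abs_boolSign, one_mul, abs_of_pos h3]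

theorem tetrahedronVertices_eq_range :
    tetrahedronVertices = range (stdVertex ∘ evenVertex) := by
  have h3 : 0 < (√3)⁻¹ := by positivity
  have key : ∀ s, 0 < stdVertex s 0 * stdVertex s 1 * stdVertex s 2 ↔
      s ∈ range evenVertex := by
    intro s
    have e : stdVertex s 0 * stdVertex s 1 * stdVertex s 2 =
        boolSign (s 0) * boolSign (s 1) * boolSign (s 2) * (√3)⁻¹ ^ 3 := by
      simp only [stdVertex_apply]; ring
    have d : ∀ s : CubeVertex, s ∈ range evenVertex ↔ (s 0 ^^ s 1 ^^ s 2) = true := by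
      simp only [mem_range]; decide
    rw [e, mul_pos_iff_of_pos_right (pow_pos h3 3), d]
    cases s 0 <;> cases s 1 <;> cases s 2 <;> simp [boolSign]
  rw [tetrahedronVertices, cubeVertices_eq_range, range_comp]
  ext x
  constructor
  · rintro ⟨⟨s, rfl⟩, hs⟩
    exact ⟨s, (key s).1 hs, rfl⟩
  · rintro ⟨s, hs, rfl⟩
    exact ⟨⟨s, rfl⟩, (key s).2 hs⟩

theorem norm_stdVertex (s : CubeVertex) : ‖stdVertex s‖ = 1 := by
  have h : ‖stdVertex s‖ ^ 2 = 1 := by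
    rw [E3_norm_sq]
    simp only [stdVertex_apply, mul_pow, sq (boolSign _), boolSign_mul_self, inv_pow]
    rw [Real.sq_sqrt (by norm_num)]
    norm_num
  nlinarith [norm_nonneg (stdVertex s)]

theorem dist_stdVertex_sq (s t : CubeVertex) :
    dist (stdVertex s) (stdVertex t) ^ 2 = 4 / 3 * hammingDist s t := by
  have e : ∀ a b : Bool, (boolSign a * (√3)⁻¹ - boolSign b * (√3)⁻¹) ^ 2 =
      if a ≠ b then 4 / 3 else 0 := by
    intro a b
    rw [← sub_mul, mul_pow, inv_pow, Real.sq_sqrt (by norm_num)]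
    cases a <;> cases b <;> simp [boolSign] <;> norm_num
  rw [E3_dist_sq]
  simp only [stdVertex_apply, e, hammingDist, Finset.card_filter, Fin.sum_univ_three]
  push_cast
  split_ifs <;> norm_num

/-! ### Regular ideal cubes and tetrahedra -/

/-- The covector of the affine function `1 / √3 ∓ x k`, which vanishes on a facet of the inscribed
cube. -/
noncomputable def facetRow (k : Fin 3) (ε : Bool) : Fin 4 → ℝ :=
  Fin.cons (√3)⁻¹ fun i => if i = k then -boolSign ε else 0

theorem facetRow_stdVertex (k : Fin 3) (ε : Bool) (s : CubeVertex) :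
    facetRow k ε ⬝ᵥ hom (stdVertex s) = if s k = ε then 0 else 2 * (√3)⁻¹ := by
  have e : facetRow k ε ⬝ᵥ hom (stdVertex s) =
      (√3)⁻¹ - boolSign ε * (boolSign (s k) * (√3)⁻¹) := by
    rw [dotProduct, Fin.sum_univ_succ]
    have : ∀ i : Fin 3, hom (stdVertex s) i.succ = boolSign (s i) * (√3)⁻¹ := by
      intro i; fin_cases i <;> rfl
    simp [facetRow, this]
    simp [hom, sub_eq_add_neg]
  rw [e]
  cases s k <;> cases ε <;> simp [boolSign] <;> ring

/-- The image of the inscribed cube under a Lorentz transformation, with its facets. -/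
noncomputable def imageConfig {A : Matrix (Fin 4) (Fin 4) ℝ} (hA : IsLorentz A) :
    CubeConfig (convexHull ℝ (range (projMap A ∘ stdVertex))) :=
  have hval : ∀ k ε s, rowAffine (facetRow k ε ᵥ* A⁻¹) (projMap A (stdVertex s)) =
      (projDenom A (stdVertex s))⁻¹ * if s k = ε then 0 else 2 * (√3)⁻¹ := fun k ε s => by
    have h := hA.denom_pos _ (norm_stdVertex s).le
    rw [rowAffine_apply, hom_projMap h.ne', dotProduct_smul, dotProduct_mulVec, vecMul_vecMul,
      Matrix.nonsing_inv_mul _ (isUnit_iff_ne_zero.2 hA.det_ne_zero), vecMul_one, smul_eq_mul,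
      facetRow_stdVertex]
  { convex := convex_convexHull ℝ _
    v := projMap A ∘ stdVertex
    f := fun k ε => rowAffine (facetRow k ε ᵥ* A⁻¹)
    norm_v := fun s => hA.norm_projMap_eq_one (norm_stdVertex s)
    v_mem := fun s => subset_convexHull ℝ _ (mem_range_self s)
    f_nonneg := fun k ε x hx => by
      have hc : Convex ℝ (rowAffine (facetRow k ε ᵥ* A⁻¹) ⁻¹' Ici 0) :=
        (convex_Ici 0).affine_preimage _
      refine convexHull_min ?_ hc hx
      rintro _ ⟨s, rfl⟩
      have h := hA.denom_pos _ (norm_stdVertex s).le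
      rw [mem_preimage, Function.comp_apply, hval, mem_Ici]
      positivity
    f_v := fun k ε s => by
      have h := (hA.denom_pos _ (norm_stdVertex s).le).ne'
      rw [Function.comp_apply, hval, mul_eq_zero, or_iff_right (inv_ne_zero h)]
      by_cases hs : s k = ε <;> simp [hs] }

theorem edgeProd_projMap_sq {A : Matrix (Fin 4) (Fin 4) ℝ} (hA : IsLorentz A) {u : Fin 4 → E3}
    (hu : ∀ i, ‖u i‖ = 1) (i j k l : Fin 4) :
    edgeProd (projMap A ∘ u) i j k l ^ 2 * (projDenom A (u i) * projDenom A (u j) *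
      (projDenom A (u k) * projDenom A (u l))) = edgeProd u i j k l ^ 2 := by
  have h1 := hA.dist_sq (hu i) (hu j)
  have h2 := hA.dist_sq (hu k) (hu l)
  simp only [edgeProd, Function.comp_apply, mul_pow]
  rw [← h1, ← h2]
  ring

theorem edgeProd_nonneg (v : Fin 4 → E3) (i j k l : Fin 4) : 0 ≤ edgeProd v i j k l :=
  mul_nonneg dist_nonneg dist_nonneg

/-- Regularity of an ideal tetrahedron, as the equality of the three products of opposite edges, is
invariant under Lorentz transformations. -/
theorem hypVolume_projMap_of_regular {A : Matrix (Fin 4) (Fin 4) ℝ} (hA : IsLorentz A)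
    {u : Fin 4 → E3} (hu : ∀ i, ‖u i‖ = 1) {c : ℝ} (hc : c ≠ 0)
    (h0 : edgeProd u 0 1 2 3 ^ 2 = c) (h1 : edgeProd u 0 2 1 3 ^ 2 = c)
    (h2 : edgeProd u 0 3 1 2 ^ 2 = c) :
    hypVolume (idealHull (range (projMap A ∘ u))) = regularVolume := by
  have hm : ∀ i, 0 < projDenom A (u i) := fun i => hA.denom_pos _ (hu i).le
  have hM : 0 < projDenom A (u 0) * projDenom A (u 1) * (projDenom A (u 2) * projDenom A (u 3)) :=
    mul_pos (mul_pos (hm 0) (hm 1)) (mul_pos (hm 2) (hm 3))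
  have e0 := edgeProd_projMap_sq hA hu 0 1 2 3
  have e1 := edgeProd_projMap_sq hA hu 0 2 1 3
  have e2 := edgeProd_projMap_sq hA hu 0 3 1 2
  rw [h0] at e0
  rw [h1, mul_mul_mul_comm] at e1
  rw [h2, show projDenom A (u 0) * projDenom A (u 3) * (projDenom A (u 1) * projDenom A (u 2)) =
    projDenom A (u 0) * projDenom A (u 1) * (projDenom A (u 2) * projDenom A (u 3)) by ring] at e2
  refine hypVolume_of_regular (fun i => hA.norm_projMap_eq_one (hu i)) ?_ ?_ ?_
  · intro h
    rw [h] at e0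
    exact hc (by rw [← e0]; ring)
  · refine (pow_left_inj₀ (edgeProd_nonneg _ _ _ _ _) (edgeProd_nonneg _ _ _ _ _) two_ne_zero).1 ?_
    exact mul_right_cancel₀ hM.ne' (e1.trans e0.symm)
  · refine (pow_left_inj₀ (edgeProd_nonneg _ _ _ _ _) (edgeProd_nonneg _ _ _ _ _) two_ne_zero).1 ?_
    exact mul_right_cancel₀ hM.ne' (e2.trans e0.symm)

theorem edgeProd_stdVertex_sq (t : Fin 4 → CubeVertex) (i j k l : Fin 4) :
    edgeProd (stdVertex ∘ t) i j k l ^ 2 =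
      16 / 9 * (hammingDist (t i) (t j) * hammingDist (t k) (t l) : ℕ) := by
  simp only [edgeProd, Function.comp_apply, mul_pow, dist_stdVertex_sq]
  push_cast
  ring

/-- For vertices of the inscribed cube, squared distances are proportional to Hamming distances. -/
theorem hypVolume_projMap_stdVertex {A : Matrix (Fin 4) (Fin 4) ℝ} (hA : IsLorentz A)
    {t : Fin 4 → CubeVertex} {n : ℕ} (hn : n ≠ 0)
    (h0 : hammingDist (t 0) (t 1) * hammingDist (t 2) (t 3) = n)
    (h1 : hammingDist (t 0) (t 2) * hammingDist (t 1) (t 3) = n)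
    (h2 : hammingDist (t 0) (t 3) * hammingDist (t 1) (t 2) = n) :
    hypVolume (idealHull (range (projMap A ∘ stdVertex ∘ t))) = regularVolume := by
  refine hypVolume_projMap_of_regular hA (c := 16 / 9 * n) (fun i => norm_stdVertex _)
    (by positivity) ?_ ?_ ?_
  · rw [edgeProd_stdVertex_sq, h0]
  · rw [edgeProd_stdVertex_sq, h1]
  · rw [edgeProd_stdVertex_sq, h2]

theorem hypVolume_projMap_evenVertex {A : Matrix (Fin 4) (Fin 4) ℝ} (hA : IsLorentz A) :
    hypVolume (idealHull (range (projMap A ∘ stdVertex ∘ evenVertex))) = regularVolume :=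
  hypVolume_projMap_stdVertex hA (n := 4) (by norm_num) (by decide) (by decide) (by decide)

/-- All five tetrahedra of a regular ideal cube are regular. -/
theorem hypVolume_imageConfig_tet {A : Matrix (Fin 4) (Fin 4) ℝ} (hA : IsLorentz A)
    (a : Option (Fin 4)) : hypVolume (idealHull (range ((imageConfig hA).tet a))) =
      regularVolume := by
  cases a with
  | none => exact hypVolume_projMap_evenVertex hA
  | some i =>
    have d : ∀ i, hammingDist (corner (oddVertex i) 0) (corner (oddVertex i) 1) *
          hammingDist (corner (oddVertex i) 2) (corner (oddVertex i) 3) = 2 ∧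
        hammingDist (corner (oddVertex i) 0) (corner (oddVertex i) 2) *
          hammingDist (corner (oddVertex i) 1) (corner (oddVertex i) 3) = 2 ∧
        hammingDist (corner (oddVertex i) 0) (corner (oddVertex i) 3) *
          hammingDist (corner (oddVertex i) 1) (corner (oddVertex i) 2) = 2 := by decide
    exact hypVolume_projMap_stdVertex hA (t := corner (oddVertex i)) (n := 2) (by norm_num)
      (d i).1 (d i).2.1 (d i).2.2

theorem range_stdVertex_subset_sphere : range stdVertex ⊆ Metric.sphere 0 1 := by
  rintro _ ⟨s, rfl⟩
  simp [norm_stdVertex]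

theorem IsHypIsometry.exists_image_idealHull {φ : E3 → E3} (h : IsHypIsometry φ) :
    ∃ A, IsLorentz A ∧ ∀ V ⊆ Metric.sphere (0 : E3) 1,
      φ '' idealHull V = idealHull (projMap A '' V) := by
  obtain ⟨A, hA, hφ⟩ := h.exists_isLorentz
  refine ⟨A, hA, fun V hV => ?_⟩
  rw [← hA.image_idealHull hV]
  exact image_congr fun x hx => hφ x hx.2

theorem IsRegularIdealTetrahedron.hypVolume_eq {T : Set E3} (h : IsRegularIdealTetrahedron T) :
    hypVolume T = regularVolume := by
  obtain ⟨φ, hφ, rfl⟩ := h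
  obtain ⟨A, hA, hAφ⟩ := hφ.exists_image_idealHull
  rw [tetrahedronVertices_eq_range, hAφ _ ((range_comp_subset_range _ _).trans
    range_stdVertex_subset_sphere), ← range_comp]
  exact hypVolume_projMap_evenVertex hA

/-- A regular ideal cube is an ideal polyhedron of cube type that is cut into five regular ideal
tetrahedra. -/
theorem IsRegularIdealCube.properties {R : Set E3} (h : IsRegularIdealCube R) :
    (IsIdealPolyhedron R ∧ HasCubeType R) ∧ hypVolume R = 5 * regularVolume := by
  obtain ⟨φ, hφ, rfl⟩ := h
  obtain ⟨A, hA, hAφ⟩ := hφ.exists_image_idealHull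
  rw [cubeVertices_eq_range, hAφ _ range_stdVertex_subset_sphere, ← range_comp]
  have hf : (range (projMap A ∘ stdVertex)).Finite := finite_range _
  have hV : range (projMap A ∘ stdVertex) ⊆ Metric.sphere 0 1 := by
    rintro _ ⟨s, rfl⟩
    simpa using hA.norm_projMap_eq_one (norm_stdVertex s)
  have ht : affineSpan ℝ (range (projMap A ∘ stdVertex)) = ⊤ := by
    rw [eq_top_iff, ← affineSpan_range_eq_top ((imageConfig hA).tet_det_ne_zero none)]
    exact affineSpan_mono ℝ (range_comp_subset_range evenVertex (projMap A ∘ stdVertex))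
  refine ⟨⟨⟨_, hf, hV, ht, rfl⟩, ?_⟩, ?_⟩
  · rw [HasCubeType, closure_idealHull hf hV ht, range_comp,
      ← projMap_image_convexHull (convex_closedBall (0 : E3) 1)
        (fun x hx => hA.denom_pos x (by simpa using hx))
        (range_stdVertex_subset_sphere.trans Metric.sphere_subset_closedBall)]
    have h3 : (0 : ℝ) < √3 := by positivity
    have hpos : ∀ x, 0 < projDenom scaleMatrix x := fun x => by rwa [projDenom_scaleMatrix]
    have hcube : convexHull ℝ (range stdVertex) = projMap scaleMatrix '' euclideanCube := by
      rw [euclideanCube_eq_convexHull, projMap_image_convexHull convex_univ (fun x _ => hpos x)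
        (subset_univ _), ← range_comp]
      congr 2
      ext1 s
      exact (projMap_scaleMatrix s).symm
    have hsub : convexHull ℝ (range stdVertex) ⊆ Metric.closedBall 0 1 :=
      convexHull_subset_closedBall (by rintro _ ⟨s, rfl⟩; exact (norm_stdVertex s).le)
    obtain ⟨e₁⟩ := nonempty_faceLattice_orderIso_projMap hA.det_ne_zero
      (K := convexHull ℝ (range stdVertex))
      fun x hx => hA.denom_pos x (by simpa using hsub hx)
    obtain ⟨e₂⟩ := nonempty_faceLattice_orderIso_projMap (A := scaleMatrix) (K := euclideanCube)
      (by simp [scaleMatrix, det_diagonal, Fin.prod_univ_four]) fun x _ => hpos x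
    rw [← hcube] at e₂
    exact ⟨e₁.trans e₂⟩
  · rw [idealHull, (imageConfig hA).hypVolume_eq_sum]
    simp [hypVolume_imageConfig_tet]

theorem mainTheorem6 (R : Set E3) (hR : IsRegularIdealCube R)
    (T : Set E3) (hT : IsRegularIdealTetrahedron T) :
    (IsIdealPolyhedron R ∧ HasCubeType R) ∧
      (∀ Q : Set E3, IsIdealPolyhedron Q → HasCubeType Q → hypVolume Q ≤ hypVolume R) ∧
      hypVolume R = 5 * hypVolume T ∧ hypVolume T < ⊤ := by
  obtain ⟨hRQ, hvol⟩ := hR.properties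
  rw [hT.hypVolume_eq, hvol]
  exact ⟨hRQ, fun Q hQ hQc => hypVolume_le_of_hasCubeType hQ hQc, rfl, regularVolume_lt_top⟩
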